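/- Let $X$ be a proper metric space and let $A\subseteq X$ be a closed non-empty subset; put $\Omega=X\setminus A$. Call a metric space $Y$ a non-negatively curved Alexandrov space if it is complete, any two of its points are joined by a constant speed geodesic, and the following comparison holds: for all $p,q,r\in Y$, every geodesic $[qr]$ in $Y$, every triangle $\tilde p\tilde q\tilde r$ in $\mathbb R^2$ with the same side lengths $d(p,q),d(q,r),d(r,p)$, and every $x\in[qr]$, the point $\tilde x\in[\tilde q\tilde r]$ with $|\tilde q-\tilde x|=d(q,x)$ satisfies $d(p,x)\ge|\tilde p-\tilde x|$. Let $\mathcal M_2(X,A)$ be the set of non-negative Radon measures $\mu$ on $\Omega$ with $\int_\Omega d(x,A)^2\,d\mu(x)<\infty$, and let $$\mathrm{Wb}_2(\mu,\nu)=\inf_\gamma\Big(\int_{E_\Omega}d(x,y)^2\,d\gamma(x,y)\Big)^{1/2},$$ where $\gamma$ ranges over the non-negative Borel measures on $E_\Omega=(X\times X)\setminus(A\times A)$ whose first and second marginals, restricted to $\Omega$, are $\mu$ and $\nu$. Let $\mathcal D_2(X,A)$ be the set of countable multisets $\sigma$ of points of $X$, two of them being identified if they agree up to adding points of $A$, with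 $\sum_{x\in\sigma}d(x,A)^2<\infty$, and let $$d_2(\sigma,\tau)=\inf_\varphi\Big(\sum_{x}d(x,\varphi(x))^2\Big)^{1/2},$$ where $\varphi$ ranges over all bijections between a representative of $\sigma$ and a representative of $\tau$. Suppose that $X$ is a non-negatively curved Alexandrov space. Then $\mathrm{Wb}_2$ is a (finite) metric on $\mathcal M_2(X,A)$ and $(\mathcal M_2(X,A),\mathrm{Wb}_2)$ is a non-negatively curved Alexandrov space. Likewise, $d_2$ is a (finite) metric on $\mathcal D_2(X,A)$ and $(\mathcal D_2(X,A),d_2)$ is a non-negatively curved Alexandrov space. -/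

import Mathlib

open scoped ENNReal

namespace OptPartial

section Metric

/-- A constant speed (minimising) geodesic `ξ : [0,1] → Y`; continuity is automatic. -/
def IsGeodesic {Y : Type*} [MetricSpace Y] (ξ : unitInterval → Y) : Prop :=
  ∀ s t : unitInterval, dist (ξ s) (ξ t) = dist (ξ 0) (ξ 1) * |(s : ℝ) - (t : ℝ)|

/-- Any two points are the endpoints of a constant speed geodesic. -/
def IsGeodesicSpace (Y : Type*) [MetricSpace Y] : Prop :=
  ∀ x y : Y, ∃ ξ : unitInterval → Y, IsGeodesic ξ ∧ ξ 0 = x ∧ ξ 1 = y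

/-- The triangle comparison condition with the Euclidean plane: for a point `p`, a geodesic `ξ`
from `q` to `r`, any comparison triangle `p' q' r'` in the plane, and any point `x = ξ t` of the
side `[q r]`, the corresponding point `x'` of the segment `[q' r']` satisfies
`d(p', x') ≤ d(p, x)`. (The sides `[p q]` and `[r p]` of the triangle play no role, and
they exist in every geodesic space.) -/
def TriangleComparison (Y : Type*) [MetricSpace Y] : Prop :=
  ∀ (p q r : Y) (ξ : unitInterval → Y), IsGeodesic ξ → ξ 0 = q → ξ 1 = r →
    ∀ p' q' r' : EuclideanSpace ℝ (Fin 2),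
      dist p' q' = dist p q → dist q' r' = dist q r → dist r' p' = dist r p →
      ∀ t : unitInterval, ∀ x' ∈ segment ℝ q' r', dist q' x' = dist q (ξ t) →
        dist p' x' ≤ dist p (ξ t)

/-- Alexandrov spaces of non-negative curvature (globally, with no condition on dimension):
complete geodesic spaces satisfying triangle comparison with the Euclidean plane. -/
structure IsNonnegCurvedAlexandrov (Y : Type*) [MetricSpace Y] : Prop where
  complete : CompleteSpace Y
  geodesic : IsGeodesicSpace Y
  comparison : TriangleComparison Y

end Metric

section Measures

/-- The set `M_p(X, A)` of Radon measures `μ` on `Ω = X \ A` (finite on compact sets and inner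
regular on Borel sets with respect to compact sets) with `∫_Ω d(x, A)^p dμ(x) < ∞`. -/
def RadonMeasures {X : Type*} [MetricSpace X] [MeasurableSpace X] (p : ℝ) (A : Set X) :
    Type _ :=
  {μ : MeasureTheory.Measure (Aᶜ : Set X) //
    MeasureTheory.IsFiniteMeasureOnCompacts μ ∧ μ.InnerRegular ∧
      ∫⁻ x, Metric.infEDist (x : X) A ^ p ∂μ < ∞}

/-- Admissible partial transport plans between `μ` and `ν`: Borel measures on
`E_Ω = X × X \ A × A` whose marginals, restricted to `Ω = X \ A`, are `μ` and `ν`. -/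
def Adm {X : Type*} [MetricSpace X] [MeasurableSpace X] {A : Set X}
    (μ ν : MeasureTheory.Measure (Aᶜ : Set X)) :
    Set (MeasureTheory.Measure ((A ×ˢ A)ᶜ : Set (X × X))) :=
  {γ | (γ.map (fun z : ((A ×ˢ A)ᶜ : Set (X × X)) => (z : X × X).1)).comap Subtype.val = μ ∧
       (γ.map (fun z : ((A ×ˢ A)ᶜ : Set (X × X)) => (z : X × X).2)).comap Subtype.val = ν}

/-- The optimal partial transport distance
`Wb_p(μ, ν) = inf_γ (∫_{E_Ω} d(x, y)^p dγ(x, y))^{1/p}`, over admissible `γ`. -/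
noncomputable def Wb {X : Type*} [MetricSpace X] [MeasurableSpace X] {A : Set X} (p : ℝ)
    (μ ν : RadonMeasures p A) : ℝ≥0∞ :=
  ⨅ γ ∈ Adm μ.1 ν.1, (∫⁻ z, edist (z : X × X).1 (z : X × X).2 ^ p ∂γ) ^ (1 / p)

end Measures

section Diagrams

/-- The set `D_p(X, A)` of persistence diagrams. Countable multisets in `X` are identified when
they agree up to adding points of `A`, so a class is the same as the multiplicity function of its
points in `Ω = X \ A`; the sum of the `d(x, A)^p` over these points is required to be
finite, which forces countable support and finite multiplicities. -/
def PersistenceDiagrams {X : Type*} [MetricSpace X] (p : ℝ) (A : Set X) : Type _ :=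
  {σ : (Aᶜ : Set X) → ℕ // ∑' x : (Aᶜ : Set X), (σ x : ℝ≥0∞) * Metric.infEDist (x : X) A ^ p < ∞}

/-- The sequence `u` enumerates (with multiplicity) a multiset in the class `σ`, i.e. the points of
`σ` together with some points of `A`. -/
def Enumerates {X : Type*} {A : Set X} (u : ℕ → X) (σ : (Aᶜ : Set X) → ℕ) : Prop :=
  ∀ x : (Aᶜ : Set X), {i | u i = x}.encard = (σ x : ℕ∞)

/-- The `p`-Wasserstein distance between persistence diagrams: the infimum of
`(∑ d(x, φ x)^p)^{1/p}` over all bijections `φ` between representatives of the two classes.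
A bijection is recorded by the sequence of its pairs `(u i, v i) = (x, φ x)`; when `A` is not empty,
sequences over `ℕ` suffice, as a finite one can be continued by pairs `(a, a)` with `a ∈ A`. -/
noncomputable def diagramDist {X : Type*} [MetricSpace X] {A : Set X} (p : ℝ)
    (σ τ : PersistenceDiagrams p A) : ℝ≥0∞ :=
  ⨅ (u : ℕ → X) (v : ℕ → X) (_ : Enumerates u σ.1) (_ : Enumerates v τ.1),
    (∑' i, edist (u i) (v i) ^ p) ^ (1 / p)

end Diagrams

end OptPartial

open MeasureTheory Set Filter Topology ProbabilityTheory
open scoped NNReal CompactlySupported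

set_option linter.unusedSectionVars false

/-! Both spaces are instances of one construction. Extending by zero, a measure on `Ω` becomes a
measure on `X` that is null on `A` and has finite second moment relative to `A`; a diagram becomes
such a measure that is moreover a countable sum of Dirac masses. A proposition `b` records whether
measures and plans must be point measures, and everything is proved once for the distance `planCost
b A μ ν ^ (1 / 2)`, where plans may carry any mass on `A` (`exists_alexandrov_of_planCost`).

Existence of optimal plans, completeness and geodesics all rest on vague compactness along an
ultrafilter. Bounded moments bound the mass of compact sets away from `A`, so limits exist by the
Riesz theorem; bounded cost stops mass from escaping to infinity, so limits of plans have the right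
marginals (`lintegral_fst_eq_of_vagueLim`, `exists_plan_of_vagueLim`); the cost is lower
semicontinuous; and limits of point measures are point measures, because the masses of small balls
are integers.

Plans issuing from one measure are glued (`exists_star`): by disintegration in general, by matching
atoms for point measures. What cannot be matched lies over `A` and is kept in place, at no cost.
Gluing along the middle measure and Minkowski's inequality give the triangle inequality.

Geodesics are ultralimits of push-forwards of an optimal plan along almost-geodesics of `X`. These
are chosen measurably by replacing endpoints by members of a countable dense set.

Triangle comparison is equivalent to `(1 - t) d(p,q)² + t d(p,r)² ≤ d(p,x)² + t (1 - t) d(q,r)²`,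
which is linear in squared distances and so can be integrated. Optimal plans from `x` to `p`, `q`,
`r` are glued at `x`. Equality in an integrated Cauchy-Schwarz inequality shows that almost every
triple has its `x`-point on a geodesic of `X` between its `q`- and `r`-points, at ratio `t`.
Integrating the inequality of `X` then bounds the plan costs as required (`Represents.comparison`).
-/

namespace OptPartial

/-! ### Vague limits of measures along an ultrafilter -/

section Vague

variable {Z : Type*} [MetricSpace Z] [ProperSpace Z] [MeasurableSpace Z] [BorelSpace Z]

/-- Vague convergence along a filter of measures on an open set `O`, tested against non-negative
continuous functions with compact support in `O`. -/
def VagueLim {Z : Type*} [TopologicalSpace Z] [MeasurableSpace Z] (U : Filter ℕ) (O : Set Z)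
    (γn : ℕ → Measure Z) (γ : Measure Z) : Prop :=
  ∀ f : Z → ℝ≥0, Continuous f → HasCompactSupport f → tsupport f ⊆ O →
    Tendsto (fun n => ∫⁻ z, f z ∂γn n) U (𝓝 (∫⁻ z, f z ∂γ))

lemma lintegral_le_of_tsupport_subset {Z : Type*} [TopologicalSpace Z] [MeasurableSpace Z]
    [BorelSpace Z] {f : Z → ℝ≥0} (hf : Continuous f)
    (hc : HasCompactSupport f) : ∃ M : ℝ≥0, ∀ γ : Measure Z, ∫⁻ z, f z ∂γ ≤ M * γ (tsupport f) := by
  obtain ⟨M, hM⟩ : ∃ M : ℝ≥0, ∀ z, f z ≤ M := by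
    obtain ⟨M, hM⟩ := (hc.isCompact_range hf).bddAbove
    exact ⟨M, fun z => hM ⟨z, rfl⟩⟩
  refine ⟨M, fun γ => ?_⟩
  rw [← setLIntegral_eq_of_support_subset (s := tsupport f)]
  · calc ∫⁻ z in tsupport f, f z ∂γ ≤ ∫⁻ z in tsupport f, M ∂γ :=
          lintegral_mono fun z => ENNReal.coe_le_coe.2 (hM z)
      _ = M * γ (tsupport f) := by simp
  · intro z hz
    apply subset_tsupport f
    simpa using hz

/-- Ultrafilter limits of integrals always exist in `[0, ∞]`, and the local mass bounds keep them
finite. They depend linearly on the test function, so the Riesz–Markov–Kakutani theorem represents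
them by a measure. -/
lemma exists_vagueLim_of_univ {Z : Type*} [TopologicalSpace Z] [T2Space Z] [LocallyCompactSpace Z]
    [MeasurableSpace Z] [BorelSpace Z] (U : Ultrafilter ℕ) (γn : ℕ → Measure Z)
    (hb : ∀ K, IsCompact K → ∃ C : ℝ≥0, ∀ n, γn n K ≤ C) :
    ∃ γ : Measure Z, γ.Regular ∧ ∀ f : C_c(Z, ℝ≥0),
      Tendsto (fun n => ∫⁻ z, f z ∂γn n) U (𝓝 (∫⁻ z, f z ∂γ)) := by
  have hbound : ∀ f : C_c(Z, ℝ≥0), ∃ C : ℝ≥0, ∀ n, ∫⁻ z, f z ∂γn n ≤ C := by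
    intro f
    obtain ⟨M, hM⟩ := lintegral_le_of_tsupport_subset f.continuous f.hasCompactSupport
    obtain ⟨C, hC⟩ := hb (tsupport f) f.hasCompactSupport
    refine ⟨M * C, fun n => (hM _).trans ?_⟩
    push_cast
    gcongr
    exact hC n
  have hlim : ∀ f : C_c(Z, ℝ≥0), ∃ L : ℝ≥0,
      Tendsto (fun n => ∫⁻ z, f z ∂γn n) U (𝓝 (L : ℝ≥0∞)) := by
    intro f
    obtain ⟨C, hC⟩ := hbound f
    have h1 := (U.map (fun n => ∫⁻ z, f z ∂γn n)).le_nhds_lim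
    have h2 : (U.map (fun n => ∫⁻ z, f z ∂γn n)).lim ≤ C :=
      le_of_tendsto (f := fun n => ∫⁻ z, f z ∂γn n) (x := (U : Filter ℕ)) h1
        (Eventually.of_forall hC)
    refine ⟨(U.map (fun n => ∫⁻ z, f z ∂γn n)).lim.toNNReal, ?_⟩
    rw [ENNReal.coe_toNNReal (ne_top_of_le_ne_top ENNReal.coe_ne_top h2)]
    exact h1
  choose L hL using hlim
  let Λ : C_c(Z, ℝ≥0) →ₗ[ℝ≥0] ℝ≥0 :=
    { toFun := L
      map_add' := fun f g => by
        have h := (hL f).add (hL g)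
        have h' := hL (f + g)
        have e : ∀ n, ∫⁻ z, (f + g) z ∂γn n = ∫⁻ z, f z ∂γn n + ∫⁻ z, g z ∂γn n := by
          intro n
          rw [← lintegral_add_left (by fun_prop)]
          simp
        simp_rw [e] at h'
        exact_mod_cast tendsto_nhds_unique h' h
      map_smul' := fun c f => by
        have h := ENNReal.Tendsto.const_mul (a := (c : ℝ≥0∞)) (hL f) (Or.inr ENNReal.coe_ne_top)
        have h' := hL (c • f)
        have e : ∀ n, ∫⁻ z, (c • f) z ∂γn n = c * ∫⁻ z, f z ∂γn n := by
          intro n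
          rw [← lintegral_const_mul _ (by fun_prop)]
          simp
        simp_rw [e] at h'
        simpa using (by exact_mod_cast tendsto_nhds_unique h' h : L (c • f) = c * L f) }
  refine ⟨NNRealRMK.rieszMeasure Λ, inferInstance, fun f => ?_⟩
  rw [NNRealRMK.lintegral_rieszMeasure]
  exact hL f

lemma exists_vagueLim (U : Ultrafilter ℕ) {O : Set Z} (hO : IsOpen O) (γn : ℕ → Measure Z)
    (hb : ∀ K ⊆ O, IsCompact K → ∃ C : ℝ≥0, ∀ n, γn n K ≤ C) :
    ∃ γ : Measure Z, γ Oᶜ = 0 ∧ (∀ K ⊆ O, IsCompact K → γ K < ∞) ∧ VagueLim U O γn γ := by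
  have : LocallyCompactSpace O := hO.locallyCompactSpace
  have hme : MeasurableEmbedding (Subtype.val : O → Z) :=
    MeasurableEmbedding.subtype_coe hO.measurableSet
  obtain ⟨γ, hγ, hlim⟩ := exists_vagueLim_of_univ U (fun n => (γn n).comap (Subtype.val : O → Z))
    (by
      intro K hK
      obtain ⟨C, hC⟩ := hb (Subtype.val '' K) (by simp) (hK.image continuous_subtype_val)
      refine ⟨C, fun n => ?_⟩
      rw [hme.comap_apply]
      exact hC n)
  have hpre : ∀ K ⊆ O, IsCompact K → IsCompact ((Subtype.val : O → Z) ⁻¹' K) := by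
    intro K hKO hK
    exact IsInducing.subtypeVal.isCompact_preimage' hK (by simpa using hKO)
  refine ⟨γ.map Subtype.val, ?_, ?_, ?_⟩
  · rw [hme.map_apply]
    simp
  · intro K hKO hK
    rw [hme.map_apply]
    exact (hpre K hKO hK).measure_lt_top
  · intro f hf hc hs
    have hcs : HasCompactSupport (f ∘ (Subtype.val : O → Z)) := by
      apply HasCompactSupport.of_support_subset_isCompact (hpre _ hs hc)
      intro z hz
      exact subset_tsupport f hz
    have := hlim ⟨⟨f ∘ Subtype.val, hf.comp continuous_subtype_val⟩, hcs⟩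
    rw [hme.lintegral_map]
    refine (tendsto_congr fun n => ?_).1 this
    symm
    change _ = ∫⁻ z : O, (f z : ℝ≥0∞) ∂_
    rw [← hme.lintegral_map (fun z => (f z : ℝ≥0∞)), hme.map_comap, Subtype.range_coe,
      setLIntegral_eq_of_support_subset]
    intro z hz
    apply hs
    apply subset_tsupport f
    simpa using hz

lemma exists_bump {Z : Type*} [MetricSpace Z] [ProperSpace Z] {K O : Set Z} (hK : IsCompact K)
    (hO : IsOpen O) (h : K ⊆ O) :
    ∃ f : Z → ℝ≥0, Continuous f ∧ HasCompactSupport f ∧ tsupport f ⊆ O ∧ (∀ z ∈ K, f z = 1) ∧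
      ∀ z, f z ≤ 1 := by
  obtain ⟨f, h1, h2, h3, h4⟩ := exists_continuousMap_one_of_isCompact_subset_isOpen hK hO h
  refine ⟨fun z => (f z).toNNReal, by fun_prop, ?_, ?_, ?_, ?_⟩
  · exact HasCompactSupport.comp_left (f := f) (g := Real.toNNReal) h2 (by simp)
  · refine (closure_mono ?_).trans h3
    exact Function.support_comp_subset (g := Real.toNNReal) (by simp) f
  · intro z hz
    simp [h1 hz]
  · intro z
    simpa using (h4 z).2

/-- An open subset of a proper space has an exhaustion by compact sets. -/
lemma exists_compact_exhaustion {Z : Type*} [MetricSpace Z] [ProperSpace Z]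
    {O : Set Z} (hO : IsOpen O) :
    ∃ K : ℕ → Set Z, (∀ n, IsCompact (K n)) ∧ Monotone K ∧ ⋃ n, K n = O := by
  have : LocallyCompactSpace O := hO.locallyCompactSpace
  let E : CompactExhaustion O := default
  refine ⟨fun n => Subtype.val '' E n, fun n => (E.isCompact n).image continuous_subtype_val,
    fun m n h => image_mono (E.subset h), ?_⟩
  rw [← image_iUnion, E.iUnion_eq]
  simp

/-- Lower semicontinuity for integrands without compact support: cut `g` off by a bump equal to `1`
on a compact set, pass to the limit, then exhaust `O`. Mass may be lost at the boundary of `O` or at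
infinity, hence only an inequality. -/
lemma VagueLim.lintegral_le {U : Filter ℕ} [U.NeBot] {O : Set Z} (hO : IsOpen O)
    {γn : ℕ → Measure Z} {γ : Measure Z} (h : VagueLim U O γn γ) (h0 : γ Oᶜ = 0) {g : Z → ℝ≥0}
    (hg : Continuous g) {c : ℝ≥0∞} (hc : ∀ᶠ n in U, ∫⁻ z, g z ∂γn n ≤ c) :
    ∫⁻ z, g z ∂γ ≤ c := by
  obtain ⟨K, hK, hmono, hKO⟩ := exists_compact_exhaustion hO
  have e : ∫⁻ z, g z ∂γ = ∫⁻ z in ⋃ n, K n, g z ∂γ := by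
    rw [hKO]
    rw [← lintegral_add_compl (fun z => (g z : ℝ≥0∞)) hO.measurableSet,
      Measure.restrict_eq_zero.2 h0]
    simp
  rw [e, setLIntegral_iUnion_of_directed _ (directed_of_isDirected_le hmono)]
  refine iSup_le fun k => ?_
  obtain ⟨f, hf, hfc, hfs, hf1, hf2⟩ := exists_bump (hK k) hO (hKO ▸ subset_iUnion K k)
  have hl := h (fun z => f z * g z) (hf.mul hg) hfc.mul_right
    ((tsupport_mul_subset_left).trans hfs)
  calc ∫⁻ z in K k, g z ∂γ = ∫⁻ z in K k, ((f z * g z : ℝ≥0) : ℝ≥0∞) ∂γ := by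
        refine setLIntegral_congr_fun (hK k).measurableSet fun z hz => ?_
        simp [hf1 z hz]
    _ ≤ ∫⁻ z, ((f z * g z : ℝ≥0) : ℝ≥0∞) ∂γ := setLIntegral_le_lintegral _ _
    _ ≤ c := by
        refine le_of_tendsto hl (hc.mono fun n hn => le_trans (lintegral_mono fun z => ?_) hn)
        exact ENNReal.coe_le_coe.2 (mul_le_of_le_one_left (by simp) (hf2 z))

/-- Weighting both measures by a bump makes them finite, and finite measures are determined by
bounded continuous functions. The bump is `1` on a given compact set, so the measures agree there;
compact sets exhaust `O`. -/
lemma restrict_eq_of_lintegral_eq {O : Set Z} (hO : IsOpen O) {μ ν : Measure Z}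
    (hμ : ∀ K ⊆ O, IsCompact K → μ K < ∞) (hν : ∀ K ⊆ O, IsCompact K → ν K < ∞)
    (h : ∀ f : Z → ℝ≥0, Continuous f → HasCompactSupport f → tsupport f ⊆ O →
      ∫⁻ z, f z ∂μ = ∫⁻ z, f z ∂ν) : μ.restrict O = ν.restrict O := by
  obtain ⟨K, hK, hmono, hKO⟩ := exists_compact_exhaustion hO
  have key : ∀ k, μ.restrict (K k) = ν.restrict (K k) := by
    intro k
    obtain ⟨f, hf, hfc, hfs, hf1, hf2⟩ := exists_bump (hK k) hO (hKO ▸ subset_iUnion K k)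
    have hfin : ∀ μ : Measure Z, (∀ K ⊆ O, IsCompact K → μ K < ∞) →
        IsFiniteMeasure (μ.withDensity fun z => f z) := by
      intro μ hμ
      obtain ⟨M, hM⟩ := lintegral_le_of_tsupport_subset hf hfc
      refine isFiniteMeasure_withDensity (ne_top_of_le_ne_top ?_ (hM μ))
      exact ENNReal.mul_ne_top ENNReal.coe_ne_top (hμ _ hfs hfc).ne
    have := hfin μ hμ
    have := hfin ν hν
    have e : μ.withDensity (fun z => (f z : ℝ≥0∞)) = ν.withDensity (fun z => (f z : ℝ≥0∞)) := by
      refine ext_of_forall_lintegral_eq_of_IsFiniteMeasure fun g => ?_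
      rw [lintegral_withDensity_eq_lintegral_mul _ (by fun_prop) (by fun_prop),
        lintegral_withDensity_eq_lintegral_mul _ (by fun_prop) (by fun_prop)]
      have := h (fun z => f z * g z) (hf.mul g.continuous) hfc.mul_right
        ((tsupport_mul_subset_left).trans hfs)
      simpa using this
    ext s hs
    have e2 := congrArg (fun m : Measure Z => m (s ∩ K k)) e
    have : ∀ m : Measure Z, m.withDensity (fun z => (f z : ℝ≥0∞)) (s ∩ K k) = m (s ∩ K k) := by
      intro m
      rw [withDensity_apply _ (hs.inter (hK k).measurableSet),
        setLIntegral_congr_fun (g := fun _ => 1) (hs.inter (hK k).measurableSet)]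
      · simp
      · intro z hz
        simp [hf1 z hz.2]
    simp only [this] at e2
    rw [Measure.restrict_apply hs, Measure.restrict_apply hs, e2]
  rw [← hKO]
  exact (Measure.restrict_iUnion_congr).2 key

end Vague

/-! ### Countable sums of Dirac masses and their vague limits -/

section PointMeasures

/-- A countable sum of Dirac masses. -/
def IsPointMeasure {Z : Type*} [MeasurableSpace Z] (γ : Measure Z) : Prop :=
  ∃ (s : Set ℕ) (u : s → Z), γ = Measure.sum fun i => Measure.dirac (u i)

variable {Z Z' : Type*} [MeasurableSpace Z] [MeasurableSpace Z']

lemma isPointMeasure_sum_dirac {ι : Type*} [Countable ι] (u : ι → Z) :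
    IsPointMeasure (Measure.sum fun i => Measure.dirac (u i)) := by
  obtain ⟨f, hf⟩ := exists_injective_nat ι
  let e := Equiv.ofInjective f hf
  refine ⟨range f, fun i => u (e.symm i), ?_⟩
  ext B hB
  rw [Measure.sum_apply _ hB, Measure.sum_apply _ hB]
  exact (e.symm.tsum_eq fun i => Measure.dirac (u i) B).symm

lemma sum_dirac_map {ι : Type*} (u : ι → Z) {f : Z → Z'} (hf : Measurable f) :
    (Measure.sum fun i => Measure.dirac (u i)).map f =
      Measure.sum fun i => Measure.dirac (f (u i)) := by
  rw [Measure.map_sum hf.aemeasurable]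
  simp_rw [Measure.map_dirac' hf]

lemma sum_dirac_restrict {ι : Type*} (u : ι → Z) {B : Set Z} (hB : MeasurableSet B) :
    (Measure.sum fun i => Measure.dirac (u i)).restrict B =
      Measure.sum fun i : {i // u i ∈ B} => Measure.dirac (u i) := by
  ext C hC
  rw [Measure.restrict_apply hC, Measure.sum_apply _ (hC.inter hB), Measure.sum_apply _ hC]
  refine Eq.trans ?_ (tsum_subtype {i | u i ∈ B} fun i => Measure.dirac (u i) C).symm
  congr 1 with i
  rw [Measure.dirac_apply' _ (hC.inter hB)]
  by_cases h : u i ∈ B <;> by_cases h' : u i ∈ C <;> simp [h, h', hC]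

lemma sum_dirac_add {ι κ : Type*} (u : ι → Z) (v : κ → Z) :
    (Measure.sum fun i => Measure.dirac (u i)) + (Measure.sum fun i => Measure.dirac (v i)) =
      Measure.sum fun i : ι ⊕ κ => Measure.dirac (Sum.elim u v i) := by
  ext B hB
  rw [Measure.add_apply, Measure.sum_apply _ hB, Measure.sum_apply _ hB, Measure.sum_apply _ hB]
  rw [ENNReal.summable.tsum_sum ENNReal.summable]
  simp

lemma IsPointMeasure.map {γ : Measure Z} (h : IsPointMeasure γ) {f : Z → Z'} (hf : Measurable f) :
    IsPointMeasure (γ.map f) := by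
  obtain ⟨s, u, rfl⟩ := h
  rw [sum_dirac_map _ hf]
  exact isPointMeasure_sum_dirac _

lemma IsPointMeasure.restrict {γ : Measure Z} (h : IsPointMeasure γ) {B : Set Z}
    (hB : MeasurableSet B) : IsPointMeasure (γ.restrict B) := by
  obtain ⟨s, u, rfl⟩ := h
  rw [sum_dirac_restrict _ hB]
  exact isPointMeasure_sum_dirac _

lemma IsPointMeasure.add {γ γ' : Measure Z} (h : IsPointMeasure γ) (h' : IsPointMeasure γ') :
    IsPointMeasure (γ + γ') := by
  obtain ⟨s, u, rfl⟩ := h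
  obtain ⟨s', u', rfl⟩ := h'
  rw [sum_dirac_add]
  exact isPointMeasure_sum_dirac _

lemma sum_dirac_apply {ι : Type*} (u : ι → Z) {B : Set Z} (hB : MeasurableSet B) :
    (Measure.sum fun i => Measure.dirac (u i)) B = ((u ⁻¹' B).encard : ℝ≥0∞) := by
  rw [Measure.sum_apply _ hB]
  simp_rw [Measure.dirac_apply' _ hB]
  rw [← ENNReal.tsum_set_one]
  exact (tsum_subtype (u ⁻¹' B) fun _ => (1 : ℝ≥0∞)).symm

/-- A measure which is, near every point of a conull open set, an integer multiple of the Dirac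
mass at this point, is a point measure. -/
lemma isPointMeasure_of_locally {Z : Type*} [MetricSpace Z] [SecondCountableTopology Z]
    [MeasurableSpace Z] [BorelSpace Z] {O : Set Z} {γ : Measure Z}
    (h0 : γ Oᶜ = 0) (h : ∀ z ∈ O, ∃ k : ℕ, γ {z} = k ∧ ∃ V ∈ 𝓝 z, γ (V \ {z}) = 0) :
    IsPointMeasure γ := by
  have hall : ∀ z, ∃ k : ℕ, γ {z} = k := by
    intro z
    by_cases hz : z ∈ O
    · obtain ⟨k, hk, -⟩ := h z hz
      exact ⟨k, hk⟩
    · exact ⟨0, by simpa using measure_mono_null (by simpa using hz) h0⟩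
  choose m hm using hall
  set S : Set Z := {z | m z ≠ 0} with hS
  have hSO : S ⊆ O := by
    intro z hz
    by_contra hzO
    have : γ {z} = 0 := measure_mono_null (by simpa using hzO) h0
    rw [hm z] at this
    exact hz (by exact_mod_cast this)
  have hnull : ∀ z, z ∉ S → γ {z} = 0 := by
    intro z hz
    have : m z = 0 := by simpa [hS] using hz
    rw [hm z, this]
    simp
  -- The set `S` of atoms is discrete, hence countable because `Z` is second countable.
  have hSV : ∀ z ∈ S, ∃ V ∈ 𝓝[S] z, V ∩ S ⊆ {z} := by
    intro z hz
    obtain ⟨-, -, V, hV, hV0⟩ := h z (hSO hz)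
    refine ⟨V, mem_nhdsWithin_of_mem_nhds hV, fun w hw => ?_⟩
    by_contra hwz
    have : γ {w} = 0 := measure_mono_null (by simpa using ⟨hw.1, hwz⟩) hV0
    rw [hm w] at this
    exact hw.2 (by exact_mod_cast this)
  have hSc : S.Countable := by
    choose! V hV hVS using hSV
    obtain ⟨t, htS, htc, ht⟩ := TopologicalSpace.countable_cover_nhdsWithin hV
    refine htc.mono fun z hz => ?_
    obtain ⟨w, hw, hzw⟩ := mem_iUnion₂.1 (ht hz)
    rwa [hVS w (htS hw) ⟨hzw, hz⟩]
  have hOS : γ Sᶜ = 0 := by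
    have : γ (O \ S) = 0 := by
      refine measure_null_of_locally_null _ fun z hz => ?_
      obtain ⟨-, -, V, hV, hV0⟩ := h z hz.1
      refine ⟨V, mem_nhdsWithin_of_mem_nhds hV, ?_⟩
      refine measure_mono_null (t := (V \ {z}) ∪ {z}) (fun w hw => ?_)
        (measure_union_null hV0 (hnull z hz.2))
      by_cases hwz : w = z
      · simp [hwz]
      · simp [hwz, hw]
    refine measure_mono_null (fun z hz => ?_) (measure_union_null h0 this)
    by_cases hzO : z ∈ O
    · exact Or.inr ⟨hzO, hz⟩
    · exact Or.inl hzO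
  have : Countable S := hSc.to_subtype
  have key : γ = Measure.sum fun i : (Σ z : S, Fin (m z)) => Measure.dirac (i.1 : Z) := by
    ext B hB
    have e : B ∩ S = ⋃ z : S, B ∩ {(z : Z)} := by
      ext w
      simp
    rw [Measure.sum_apply _ hB, ENNReal.tsum_sigma fun (z : S) (_ : Fin (m z)) =>
      Measure.dirac (z : Z) B, ← measure_inter_conull hOS, e, measure_iUnion]
    · congr 1 with z
      by_cases hz : (z : Z) ∈ B
      · simp [hz, hm]
      · simp [hz, Measure.dirac_apply' _ hB]
    · intro z w hzw
      simp only [Function.onFun]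
      refine Disjoint.mono inter_subset_right inter_subset_right ?_
      simpa [Subtype.ext_iff] using hzw
    · exact fun z => hB.inter (measurableSet_singleton _)
  rw [key]
  exact isPointMeasure_sum_dirac _

/-- Vague limits of point measures are point measures. -/
lemma VagueLim.isPointMeasure {Z : Type*} [MetricSpace Z] [ProperSpace Z]
    [MeasurableSpace Z] [BorelSpace Z] {U : Ultrafilter ℕ} {O : Set Z} (hO : IsOpen O)
    {γn : ℕ → Measure Z} {γ : Measure Z} (h : VagueLim U O γn γ) (h0 : γ Oᶜ = 0)
    (hfin : ∀ K ⊆ O, IsCompact K → γ K < ∞)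
    (hb : ∀ K ⊆ O, IsCompact K → ∃ C : ℝ≥0, ∀ n, γn n K ≤ C)
    (hp : ∀ n, IsPointMeasure (γn n)) : IsPointMeasure γ := by
  refine isPointMeasure_of_locally h0 fun z hz => ?_
  obtain ⟨R, hR, hRO⟩ := Metric.nhds_basis_closedBall.mem_iff.1 (hO.mem_nhds hz)
  have hcb : ∀ r ≤ R, Metric.closedBall z r ⊆ O := fun r hr =>
    (Metric.closedBall_subset_closedBall hr).trans hRO
  have hK : ∀ r, IsCompact (Metric.closedBall z r) := fun r => isCompact_closedBall z r
  -- The masses of a small ball are eventually equal to a fixed integer.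
  have hev : ∀ r ≤ R, ∃ k : ℕ, ∀ᶠ n in (U : Filter ℕ), γn n (Metric.closedBall z r) = k := by
    intro r hr
    obtain ⟨C, hC⟩ := hb _ (hcb r hr) (hK r)
    have hint : ∀ n, ∃ k : ℕ, γn n (Metric.closedBall z r) = k ∧ k ≤ ⌊C⌋₊ := by
      intro n
      obtain ⟨s, u, hu⟩ := hp n
      have h1 := hC n
      rw [hu, sum_dirac_apply _ Metric.isClosed_closedBall.measurableSet] at h1
      have hne : (u ⁻¹' Metric.closedBall z r).encard ≠ ⊤ := by
        intro htop
        rw [htop] at h1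
        simp at h1
      obtain ⟨k, hk⟩ := ENat.ne_top_iff_exists.1 hne
      refine ⟨k, ?_, ?_⟩
      · rw [hu, sum_dirac_apply _ Metric.isClosed_closedBall.measurableSet, ← hk]
        simp
      · rw [← hk] at h1
        refine Nat.le_floor ?_
        have : ((k : ℝ≥0) : ℝ≥0∞) ≤ C := by simpa using h1
        exact_mod_cast this
    choose k hk hkC using hint
    have : ∀ᶠ n in (U : Filter ℕ), k n ∈ Finset.Iic ⌊C⌋₊ :=
      Eventually.of_forall fun n => by simpa using hkC n
    -- Only finitely many integers are possible, so the ultrafilter selects one of them.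
    have h2 : ∃ j ∈ (Finset.Iic ⌊C⌋₊ : Set ℕ), k ⁻¹' {j} ∈ U := by
      rw [← Ultrafilter.finite_biUnion_mem_iff (Finset.finite_toSet _)]
      filter_upwards [this] with n hn
      simpa using hn
    obtain ⟨j, -, hj⟩ := h2
    refine ⟨j, ?_⟩
    filter_upwards [hj] with n hn
    rw [hk n, hn]
  classical
  -- Take the least integer `N` that is the eventual mass of some small ball. By minimality, all
  -- smaller concentric balls eventually have mass `N` too.
  have hex : ∃ k : ℕ, ∃ r, 0 < r ∧ r ≤ R ∧
      ∀ᶠ n in (U : Filter ℕ), γn n (Metric.closedBall z r) = k := by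
    obtain ⟨k, hk⟩ := hev R le_rfl
    exact ⟨k, R, hR, le_rfl, hk⟩
  set N := Nat.find hex with hN
  obtain ⟨r₀, hr₀, hr₀R, hNr⟩ := Nat.find_spec hex
  have hNall : ∀ r, 0 < r → r ≤ r₀ →
      ∀ᶠ n in (U : Filter ℕ), γn n (Metric.closedBall z r) = N := by
    intro r hr hrr
    obtain ⟨k, hk⟩ := hev r (hrr.trans hr₀R)
    have h1 : N ≤ k := Nat.find_min' hex ⟨r, hr, hrr.trans hr₀R, hk⟩
    have h2 : k ≤ N := by
      obtain ⟨n, hn1, hn2⟩ := (hk.and hNr).exists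
      have : γn n (Metric.closedBall z r) ≤ γn n (Metric.closedBall z r₀) :=
        measure_mono (Metric.closedBall_subset_closedBall hrr)
      rw [hn1, hn2] at this
      exact_mod_cast this
    rwa [le_antisymm h1 h2]
  -- A bump between the balls of radius `r / 2` and `r` has integral squeezed between two masses
  -- that are both eventually `N`, so its integral against `γ` is exactly `N`.
  have hbump : ∀ r, 0 < r → r ≤ r₀ → γ (Metric.closedBall z (r / 2)) ≤ N ∧
      (N : ℝ≥0∞) ≤ γ (Metric.closedBall z r) := by
    intro r hr hrr
    obtain ⟨f, hf, hfc, hfs, hf1, hf2⟩ := exists_bump (hK (r / 2)) (Metric.isOpen_ball (x := z)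
      (ε := r)) (Metric.closedBall_subset_ball (by linarith))
    have hupper : ∀ m : Measure Z, ∫⁻ w, f w ∂m ≤ m (Metric.closedBall z r) := by
      intro m
      rw [← setLIntegral_eq_of_support_subset (s := Metric.closedBall z r), ← setLIntegral_one]
      · refine lintegral_mono fun w => ?_
        have := ENNReal.coe_le_coe.2 (hf2 w)
        simpa using this
      · intro w hw
        exact Metric.ball_subset_closedBall (hfs (subset_tsupport f (by simpa using hw)))
    have hlower : ∀ m : Measure Z, m (Metric.closedBall z (r / 2)) ≤ ∫⁻ w, f w ∂m := by
      intro m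
      rw [← setLIntegral_one]
      refine le_trans (le_of_eq (setLIntegral_congr_fun
        Metric.isClosed_closedBall.measurableSet fun w hw => ?_)) (setLIntegral_le_lintegral _ _)
      simp [hf1 w hw]
    have hlim := h f hf hfc (hfs.trans (Metric.ball_subset_closedBall.trans
      (hcb r (hrr.trans hr₀R))))
    have hc : ∀ᶠ n in (U : Filter ℕ), ∫⁻ w, f w ∂γn n = N := by
      filter_upwards [hNall r hr hrr, hNall (r / 2) (by linarith) (by linarith)] with n h1 h2
      exact le_antisymm ((hupper _).trans h1.le) (h2.ge.trans (hlower _))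
    have : ∫⁻ w, f w ∂γ = N := tendsto_nhds_unique hlim
      (tendsto_const_nhds.congr' (hc.mono fun n hn => hn.symm))
    exact ⟨this ▸ hlower γ, this ▸ hupper γ⟩
  have hball : γ (Metric.closedBall z (r₀ / 2)) = N :=
    le_antisymm (hbump r₀ hr₀ le_rfl).1 (hbump (r₀ / 2) (by linarith) (by linarith)).2
  have hpt : γ {z} = N := by
    refine le_antisymm ((measure_mono ?_).trans hball.le) ?_
    · exact singleton_subset_iff.2 (Metric.mem_closedBall_self (by linarith))
    · have e : {z} = ⋂ n : ℕ, Metric.closedBall z (r₀ / (n + 1)) := by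
        ext w
        simp only [mem_singleton_iff, mem_iInter, Metric.mem_closedBall]
        constructor
        · rintro rfl n
          rw [dist_self]
          positivity
        · intro hw
          have ht : Tendsto (fun n : ℕ => r₀ / ((n : ℝ) + 1)) atTop (𝓝 0) :=
            tendsto_const_nhds.div_atTop
              (tendsto_atTop_add_const_right _ _ tendsto_natCast_atTop_atTop)
          exact dist_le_zero.1 (ge_of_tendsto' ht hw)
      rw [e, Antitone.measure_iInter]
      · refine le_iInf fun n => (hbump _ (by positivity) ?_).2
        exact div_le_self hr₀.le (by linarith [n.cast_nonneg (α := ℝ)])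
      · intro m n hmn
        exact Metric.closedBall_subset_closedBall (by gcongr)
      · exact fun n => Metric.isClosed_closedBall.measurableSet.nullMeasurableSet
      · refine ⟨0, (hfin _ (hcb _ ?_) (hK _)).ne⟩
        simpa using hr₀R
  refine ⟨N, hpt, Metric.closedBall z (r₀ / 2), Metric.closedBall_mem_nhds z (by linarith), ?_⟩
  rw [measure_sdiff (singleton_subset_iff.2 (Metric.mem_closedBall_self (by linarith)))
    (measurableSet_singleton z).nullMeasurableSet (by rw [hpt]; simp), hpt, hball]
  simp

end PointMeasures
-- Gluing measures along a common marginal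
section Glue

lemma map_withDensity_comp {α β : Type*} [MeasurableSpace α] [MeasurableSpace β] (m : Measure α)
    {f : α → β} (hf : Measurable f) {g : β → ℝ≥0∞} (hg : Measurable g) :
    (m.withDensity (g ∘ f)).map f = (m.map f).withDensity g := by
  ext s hs
  rw [Measure.map_apply hf hs, withDensity_apply _ (hf hs), withDensity_apply _ hs,
    setLIntegral_map hs hg hf]
  rfl

variable {X Y Y' : Type*} [MeasurableSpace X] [MeasurableSpace Y] [MeasurableSpace Y']

/-- Make the two second coordinates conditionally independent given the first. -/
lemma exists_glue_of_isFiniteMeasure [StandardBorelSpace Y] [Nonempty Y] [StandardBorelSpace Y']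
    [Nonempty Y'] (ρ : Measure (X × Y)) (ρ' : Measure (X × Y')) [IsFiniteMeasure ρ]
    [IsFiniteMeasure ρ'] (h : ρ.map Prod.fst = ρ'.map Prod.fst) :
    ∃ θ : Measure (X × (Y × Y')), θ.map (fun z => (z.1, z.2.1)) = ρ ∧
      θ.map (fun z => (z.1, z.2.2)) = ρ' := by
  refine ⟨ρ.fst ⊗ₘ (ρ.condKernel ×ₖ ρ'.condKernel), ?_, ?_⟩
  · have e : (fun z : X × (Y × Y') => (z.1, z.2.1)) = Prod.map id Prod.fst := rfl
    rw [e, ← Measure.compProd_map measurable_fst, ← Kernel.fst_eq, Kernel.fst_prod,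
      Measure.disintegrate]
  · have e : (fun z : X × (Y × Y') => (z.1, z.2.2)) = Prod.map id Prod.snd := rfl
    rw [e, ← Measure.compProd_map measurable_snd, ← Kernel.snd_eq, Kernel.snd_prod]
    have : ρ.fst = ρ'.fst := h
    rw [this, Measure.disintegrate]

lemma withDensity_comp_fst_inv (m : Measure (X × Y)) {D : Set X} (hD : MeasurableSet D)
    (hm : m.map Prod.fst Dᶜ = 0) {w : X → ℝ≥0∞} (hw : Measurable w) (hw0 : ∀ x ∈ D, w x ≠ 0)
    (hwt : ∀ x, w x ≠ ∞) :
    (m.withDensity (w ∘ Prod.fst)).withDensity (w⁻¹ ∘ Prod.fst) = m := by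
  refine withDensity_inv_same (by fun_prop) ?_ ?_
  · rw [Measure.map_apply measurable_fst hD.compl] at hm
    filter_upwards [(measure_eq_zero_iff_ae_notMem.1 hm)] with z hz
    exact hw0 _ (by simpa using hz)
  · exact Eventually.of_forall fun z => hwt _

lemma isFiniteMeasure_withDensity_comp_fst (m : Measure (X × Y)) {w : X → ℝ≥0∞}
    (hw : Measurable w) (hm : ∫⁻ x, w x ∂(m.map Prod.fst) < ∞) :
    IsFiniteMeasure (m.withDensity (w ∘ Prod.fst)) := by
  refine isFiniteMeasure_withDensity ?_
  rw [lintegral_map hw measurable_fst] at hm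
  exact hm.ne

lemma map_fst_restrict (m : Measure (X × Y)) {D : Set X} (hD : MeasurableSet D) :
    (m.restrict (Prod.fst ⁻¹' D)).map Prod.fst = (m.map Prod.fst).restrict D :=
  (Measure.restrict_map measurable_fst hD).symm

/-- Disintegration needs finite measures. The density `w` of the common coordinate makes both
measures finite; it is nonzero on `D`, so it can be divided out after gluing. -/
lemma exists_glue_of_lintegral [StandardBorelSpace Y] [Nonempty Y] [StandardBorelSpace Y']
    [Nonempty Y'] (ρ : Measure (X × Y)) (ρ' : Measure (X × Y'))
    (h : ρ.map Prod.fst = ρ'.map Prod.fst) {D : Set X} (hD : MeasurableSet D)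
    (hρ : ρ.map Prod.fst Dᶜ = 0) {w : X → ℝ≥0∞} (hw : Measurable w) (hw0 : ∀ x ∈ D, w x ≠ 0)
    (hwt : ∀ x, w x ≠ ∞) (hfin : ∫⁻ x, w x ∂(ρ.map Prod.fst) < ∞) :
    ∃ θ : Measure (X × (Y × Y')), θ.map (fun z => (z.1, z.2.1)) = ρ ∧
      θ.map (fun z => (z.1, z.2.2)) = ρ' := by
  have := isFiniteMeasure_withDensity_comp_fst ρ hw hfin
  have := isFiniteMeasure_withDensity_comp_fst ρ' hw (h ▸ hfin)
  obtain ⟨θ, hθ, hθ'⟩ := exists_glue_of_isFiniteMeasure (ρ.withDensity (w ∘ Prod.fst))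
    (ρ'.withDensity (w ∘ Prod.fst)) (by
      rw [map_withDensity_comp _ measurable_fst hw, map_withDensity_comp _ measurable_fst hw, h])
  refine ⟨θ.withDensity (w⁻¹ ∘ Prod.fst), ?_, ?_⟩
  · rw [← withDensity_comp_fst_inv ρ hD hρ hw hw0 hwt, ← hθ,
      ← map_withDensity_comp _ (by fun_prop) (by fun_prop)]
    rfl
  · rw [← withDensity_comp_fst_inv ρ' hD (h ▸ hρ) hw hw0 hwt, ← hθ',
      ← map_withDensity_comp _ (by fun_prop) (by fun_prop)]
    rfl

/-- Conditional independence would split atoms. Instead, over each `x` the two families have the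
same finite number of members, so they can be paired by a bijection, and the pairs are the atoms of
the gluing. -/
lemma exists_glue_of_isPointMeasure [MeasurableSingletonClass X] {ρ : Measure (X × Y)}
    {ρ' : Measure (X × Y')} (hp : IsPointMeasure ρ) (hp' : IsPointMeasure ρ')
    (h : ρ.map Prod.fst = ρ'.map Prod.fst) (hfin : ∀ x, ρ.map Prod.fst {x} ≠ ∞) :
    ∃ θ : Measure (X × (Y × Y')), IsPointMeasure θ ∧ θ.map (fun z => (z.1, z.2.1)) = ρ ∧
      θ.map (fun z => (z.1, z.2.2)) = ρ' := by
  obtain ⟨s, u, rfl⟩ := hp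
  obtain ⟨s', v, rfl⟩ := hp'
  rw [sum_dirac_map _ measurable_fst] at h hfin
  rw [sum_dirac_map _ measurable_fst] at h
  have hcard : ∀ x : X, Nonempty ({i // (u i).1 = x} ≃ {j // (v j).1 = x}) := by
    intro x
    have h1 := congrArg (fun m : Measure X => m {x}) h
    have h2 := hfin x
    simp only [sum_dirac_apply _ (measurableSet_singleton x)] at h1 h2
    have h3 : ((fun i => (u i).1) ⁻¹' {x}).Finite := by
      rw [← Set.encard_ne_top_iff]
      intro h4
      rw [h4] at h2
      simp at h2
    have h1' : ((fun i => (u i).1) ⁻¹' {x}).encard = ((fun i => (v i).1) ⁻¹' {x}).encard := by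
      exact_mod_cast h1
    have h5 : ((fun i => (v i).1) ⁻¹' {x}).Finite := by
      rwa [← Set.encard_ne_top_iff, ← h1', Set.encard_ne_top_iff]
    have : Finite {i // (u i).1 = x} := h3
    have : Finite {j // (v j).1 = x} := h5
    refine Finite.card_eq.1 ?_
    exact congrArg ENat.toNat h1'
  choose e he using fun x => (⟨(hcard x).some, trivial⟩ :
    ∃ _ : {i // (u i).1 = x} ≃ {j // (v j).1 = x}, True)
  let E : s ≃ s' := (Equiv.sigmaFiberEquiv fun i => (u i).1).symm.trans
    ((Equiv.sigmaCongrRight e).trans (Equiv.sigmaFiberEquiv fun j => (v j).1))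
  have hE : ∀ i, (v (E i)).1 = (u i).1 := fun i => (e (u i).1 ⟨i, rfl⟩).2
  refine ⟨Measure.sum fun i => Measure.dirac ((u i).1, ((u i).2, (v (E i)).2)),
    isPointMeasure_sum_dirac _, ?_, ?_⟩
  · rw [sum_dirac_map _ (by fun_prop)]
  · rw [sum_dirac_map _ (by fun_prop)]
    have : ∀ i, ((u i).1, (v (E i)).2) = v (E i) := fun i => by rw [← hE i]
    simp only [this]
    ext B hB
    rw [Measure.sum_apply _ hB, Measure.sum_apply _ hB]
    exact E.tsum_eq fun i => Measure.dirac (v i) B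

/-- Gluing of two measures along their first marginals, which are only supposed to agree on a set
`D`; on the complement of `D`, the missing component is filled in by given maps. If `b` holds then
the gluing of point measures is a point measure. -/
lemma exists_glue [MeasurableSingletonClass X] [StandardBorelSpace Y] [Nonempty Y]
    [StandardBorelSpace Y'] [Nonempty Y'] (b : Prop) {Γ : Measure (X × Y)} {Γ' : Measure (X × Y')}
    (hp : b → IsPointMeasure Γ) (hp' : b → IsPointMeasure Γ') {D : Set X} (hD : MeasurableSet D)
    (h : (Γ.map Prod.fst).restrict D = (Γ'.map Prod.fst).restrict D) {w : X → ℝ≥0∞}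
    (hw : Measurable w) (hw0 : ∀ x ∈ D, w x ≠ 0) (hwt : ∀ x, w x ≠ ∞)
    (hfin : ∫⁻ x in D, w x ∂(Γ.map Prod.fst) < ∞) {ψ : X → Y} (hψ : Measurable ψ) {ψ' : X → Y'}
    (hψ' : Measurable ψ') :
    ∃ Θ : Measure (X × (Y × Y')), (b → IsPointMeasure Θ) ∧
      Θ.map (fun z => (z.1, z.2.1)) =
        Γ + (Γ'.restrict (Prod.fst ⁻¹' Dᶜ)).map (fun z => (z.1, ψ z.1)) ∧
      Θ.map (fun z => (z.1, z.2.2)) =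
        Γ' + (Γ.restrict (Prod.fst ⁻¹' Dᶜ)).map (fun z => (z.1, ψ' z.1)) := by
  have hD' : MeasurableSet (Prod.fst ⁻¹' D : Set (X × Y)) := measurable_fst hD
  have hD'' : MeasurableSet (Prod.fst ⁻¹' D : Set (X × Y')) := measurable_fst hD
  obtain ⟨θ, hθp, hθ, hθ'⟩ : ∃ θ : Measure (X × (Y × Y')), (b → IsPointMeasure θ) ∧
      θ.map (fun z => (z.1, z.2.1)) = Γ.restrict (Prod.fst ⁻¹' D) ∧
      θ.map (fun z => (z.1, z.2.2)) = Γ'.restrict (Prod.fst ⁻¹' D) := by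
    have h1 : (Γ.restrict (Prod.fst ⁻¹' D)).map Prod.fst =
        (Γ'.restrict (Prod.fst ⁻¹' D)).map Prod.fst := by
      rw [map_fst_restrict _ hD, map_fst_restrict _ hD, h]
    have h2 : (Γ.restrict (Prod.fst ⁻¹' D)).map Prod.fst Dᶜ = 0 := by
      rw [map_fst_restrict _ hD, Measure.restrict_apply hD.compl]
      simp
    by_cases hb : b
    · obtain ⟨θ, h3, h4⟩ := exists_glue_of_isPointMeasure ((hp hb).restrict hD')
        ((hp' hb).restrict hD'') h1 (by
          intro x
          by_cases hx : x ∈ D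
          · rw [map_fst_restrict _ hD]
            intro htop
            -- An atom of infinite mass in `D`, where `w` does not vanish, would make the integral
            -- of `w` infinite.
            have : w x * ((Γ.map Prod.fst).restrict D) {x} ≤ ∫⁻ x in D, w x ∂(Γ.map Prod.fst) := by
              rw [← lintegral_singleton]
              exact setLIntegral_le_lintegral _ _
            rw [htop, ENNReal.mul_top (hw0 x hx)] at this
            exact (this.trans_lt hfin).ne rfl
          · rw [measure_mono_null (by simpa using hx) h2]
            simp)
      exact ⟨θ, fun _ => h3, h4⟩
    · obtain ⟨θ, h4⟩ := exists_glue_of_lintegral _ _ h1 hD h2 hw hw0 hwt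
        (by rwa [map_fst_restrict _ hD])
      exact ⟨θ, fun h => absurd h hb, h4⟩
  refine ⟨θ + (Γ.restrict (Prod.fst ⁻¹' Dᶜ)).map (fun z => (z.1, (z.2, ψ' z.1))) +
    (Γ'.restrict (Prod.fst ⁻¹' Dᶜ)).map (fun z => (z.1, (ψ z.1, z.2))), fun hb => ?_, ?_, ?_⟩
  · refine ((hθp hb).add ?_).add ?_
    · exact ((hp hb).restrict (measurable_fst hD.compl)).map (by fun_prop)
    · exact ((hp' hb).restrict (measurable_fst hD.compl)).map (by fun_prop)
  · rw [Measure.map_add _ _ (by fun_prop), Measure.map_add _ _ (by fun_prop), hθ,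
      Measure.map_map (by fun_prop) (by fun_prop), Measure.map_map (by fun_prop) (by fun_prop)]
    congr 1
    convert! Measure.restrict_add_restrict_compl hD'
    exact Measure.map_id
  · rw [Measure.map_add _ _ (by fun_prop), Measure.map_add _ _ (by fun_prop), hθ',
      Measure.map_map (by fun_prop) (by fun_prop), Measure.map_map (by fun_prop) (by fun_prop),
      add_right_comm]
    congr 1
    convert! Measure.restrict_add_restrict_compl hD''
    exact Measure.map_id

end Glue

/-! ### Partial transport plans and their compactness -/

section Plans

variable {X : Type*} [MetricSpace X] {b : Prop} {A : Set X}

lemma infNndist_eq_zero {x : X} (hx : x ∈ A) : Metric.infNndist x A = 0 := by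
  have : (Metric.infNndist x A : ℝ) = 0 := Metric.infDist_zero_of_mem hx
  exact_mod_cast this

lemma infNndist_pos (hA : IsClosed A) (hne : A.Nonempty) {x : X} (hx : x ∉ A) :
    0 < Metric.infNndist x A := by
  have : (0 : ℝ) < Metric.infNndist x A := (hA.notMem_iff_infDist_pos hne).1 hx
  exact_mod_cast this

lemma infNndist_le_add (x y : X) :
    Metric.infNndist x A ≤ Metric.infNndist y A + nndist x y := by
  have : (Metric.infNndist x A : ℝ) ≤ Metric.infNndist y A + nndist x y :=
    Metric.infDist_le_infDist_add_dist
  exact_mod_cast this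

variable [MeasurableSpace X]

/-- The quadratic cost of a measure on `X × X`. -/
noncomputable def cost (γ : Measure (X × X)) : ℝ≥0∞ :=
  ∫⁻ z, (nndist z.1 z.2 ^ 2 : ℝ≥0) ∂γ

/-- The integral of the squared distance to `A`. -/
noncomputable def moment (A : Set X) (μ : Measure X) : ℝ≥0∞ :=
  ∫⁻ x, (Metric.infNndist x A ^ 2 : ℝ≥0) ∂μ

/-- Measures on `X` carried by the complement of `A`, with finite second moment with respect to
`A`; if `b` holds, then they are required to be point measures. -/
structure IsAdmissible (b : Prop) (A : Set X) (μ : Measure X) : Prop where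
  null : μ A = 0
  moment_lt_top : moment A μ < ∞
  point : b → IsPointMeasure μ

/-- Plans between `μ` and `ν`, where mass may be moved from and to `A` at will; if `b` holds, then
they are required to be point measures. -/
structure IsPlan {X : Type*} [MeasurableSpace X] (b : Prop) (A : Set X) (μ ν : Measure X)
    (γ : Measure (X × X)) : Prop where
  fst : (γ.map Prod.fst).restrict Aᶜ = μ
  snd : (γ.map Prod.snd).restrict Aᶜ = ν
  point : b → IsPointMeasure γ

lemma lintegral_restrict_compl {φ : X → ℝ≥0} (hs : tsupport φ ⊆ Aᶜ)
    (μ : Measure X) : ∫⁻ x, φ x ∂(μ.restrict Aᶜ) = ∫⁻ x, φ x ∂μ := by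
  refine setLIntegral_eq_of_support_subset fun x hx => hs (subset_tsupport φ ?_)
  simpa using hx

lemma IsPlan.swap {X : Type*} [MeasurableSpace X] {b : Prop} {A : Set X} {μ ν : Measure X}
    {γ : Measure (X × X)} (h : IsPlan b A μ ν γ) :
    IsPlan b A ν μ (γ.map Prod.swap) := by
  refine ⟨?_, ?_, fun hb => (h.point hb).map measurable_swap⟩
  · rw [Measure.map_map measurable_fst measurable_swap]
    exact h.snd
  · rw [Measure.map_map measurable_snd measurable_swap]
    exact h.fst

lemma moment_restrict_compl (μ : Measure X) :
    moment A (μ.restrict Aᶜ) = moment A μ := by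
  refine setLIntegral_eq_of_support_subset fun x hx hxA => hx ?_
  simp [infNndist_eq_zero hxA]

variable [BorelSpace X]

lemma measurable_infNndist_sq : Measurable fun x => ((Metric.infNndist x A ^ 2 : ℝ≥0) : ℝ≥0∞) := by
  fun_prop

lemma moment_map {Z : Type*} [MeasurableSpace Z] (γ : Measure Z) {f : Z → X} (hf : Measurable f) :
    moment A (γ.map f) = ∫⁻ z, (Metric.infNndist (f z) A ^ 2 : ℝ≥0) ∂γ :=
  lintegral_map measurable_infNndist_sq hf

/-- Markov's inequality at the minimum of `w` on `K`. The constant does not depend on `m`, so it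
serves a whole sequence of measures. -/
lemma exists_measure_le_mul_lintegral {Z : Type*} [TopologicalSpace Z] [MeasurableSpace Z]
    [BorelSpace Z] {K : Set Z} (hK : IsCompact K) {w : Z → ℝ≥0}
    (hw : Continuous w) (hpos : ∀ z ∈ K, 0 < w z) :
    ∃ C : ℝ≥0, ∀ m : Measure Z, m K ≤ C * ∫⁻ z, w z ∂m := by
  rcases K.eq_empty_or_nonempty with rfl | hne
  · exact ⟨0, fun m => by simp⟩
  obtain ⟨z₀, hz₀, hmin⟩ := hK.exists_isMinOn hne hw.continuousOn
  refine ⟨(w z₀)⁻¹, fun m => ?_⟩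
  have h0 := hpos z₀ hz₀
  calc m K ≤ m {z | (w z₀ : ℝ≥0∞) ≤ w z} := measure_mono fun z hz => by
        simpa using hmin hz
    _ ≤ (∫⁻ z, w z ∂m) / w z₀ := meas_ge_le_lintegral_div (by fun_prop)
        (by simpa using h0.ne') ENNReal.coe_ne_top
    _ = _ := by rw [ENNReal.coe_inv h0.ne', ENNReal.div_eq_inv_mul]

lemma exists_measure_le_mul_moment (hA : IsClosed A) (hne : A.Nonempty) {K : Set X}
    (hK : IsCompact K) (hKA : K ⊆ Aᶜ) : ∃ C : ℝ≥0, ∀ m : Measure X, m K ≤ C * moment A m :=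
  exists_measure_le_mul_lintegral hK (by fun_prop) fun z hz =>
    pow_pos (infNndist_pos hA hne (hKA hz)) 2

lemma measure_lt_top_of_moment (hA : IsClosed A) (hne : A.Nonempty) {μ : Measure X}
    (hμ : moment A μ < ∞) {K : Set X} (hKA : K ⊆ Aᶜ) (hK : IsCompact K) : μ K < ∞ := by
  obtain ⟨C, hC⟩ := exists_measure_le_mul_moment hA hne hK hKA
  exact (hC μ).trans_lt (ENNReal.mul_lt_top ENNReal.coe_lt_top hμ)

lemma exists_measure_le_of_moment_le (hA : IsClosed A) (hne : A.Nonempty) {μn : ℕ → Measure X}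
    {M : ℝ≥0} (hM : ∀ n, moment A (μn n) ≤ M) {K : Set X} (hKA : K ⊆ Aᶜ) (hK : IsCompact K) :
    ∃ C : ℝ≥0, ∀ n, μn n K ≤ C := by
  obtain ⟨C, hC⟩ := exists_measure_le_mul_moment hA hne hK hKA
  refine ⟨C * M, fun n => (hC _).trans ?_⟩
  push_cast
  gcongr
  exact hM n

variable [ProperSpace X]

lemma measurable_nndist_sq :
    Measurable fun z : X × X => ((nndist z.1 z.2 ^ 2 : ℝ≥0) : ℝ≥0∞) := by
  fun_prop

lemma cost_map {Z : Type*} [MeasurableSpace Z] (γ : Measure Z) {f : Z → X × X}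
    (hf : Measurable f) : cost (γ.map f) = ∫⁻ z, (nndist (f z).1 (f z).2 ^ 2 : ℝ≥0) ∂γ :=
  lintegral_map measurable_nndist_sq hf

lemma cost_map_swap (γ : Measure (X × X)) : cost (γ.map Prod.swap) = cost γ := by
  rw [cost_map _ measurable_swap]
  simp only [Prod.fst_swap, Prod.snd_swap, nndist_comm, cost]

lemma VagueLim.map_swap {U : Filter ℕ} {γn : ℕ → Measure (X × X)} {γ : Measure (X × X)}
    (h : VagueLim U (A ×ˢ A)ᶜ γn γ) :
    VagueLim U (A ×ˢ A)ᶜ (fun n => (γn n).map Prod.swap) (γ.map Prod.swap) := by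
  intro f hf hc hs
  have := h (f ∘ Prod.swap) (hf.comp continuous_swap)
    (hc.comp_homeomorph (Homeomorph.prodComm X X)) ?_
  · simpa only [lintegral_map hf.measurable.coe_nnreal_ennreal measurable_swap] using! this
  · have e := tsupport_comp_eq_preimage f (Homeomorph.prodComm X X)
    have e' : f ∘ Prod.swap = f ∘ (Homeomorph.prodComm X X) := rfl
    rw [e', e]
    intro z hz hzA
    exact hs hz ⟨hzA.2, hzA.1⟩

/-- The function `φ z.1` is not compactly supported on `X × X`, since the second point may run to
infinity. By Chebyshev's inequality the cost bound leaves mass of order `C / k²` on pairs at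
distance at least `k`, so nothing is lost in the limit. -/
lemma lintegral_fst_eq_of_vagueLim (hA : IsClosed A) {U : Filter ℕ} [U.NeBot]
    {γn : ℕ → Measure (X × X)}
    {γ : Measure (X × X)} (h : VagueLim U (A ×ˢ A)ᶜ γn γ) (h0 : γ (A ×ˢ A) = 0) {C : ℝ≥0}
    (hC : ∀ n, cost (γn n) ≤ C) {φ : X → ℝ≥0} (hφ : Continuous φ) (hc : HasCompactSupport φ)
    (hs : tsupport φ ⊆ Aᶜ) {a : ℝ≥0∞} (ha : Tendsto (fun n => ∫⁻ z, φ z.1 ∂γn n) U (𝓝 a)) :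
    ∫⁻ z, φ z.1 ∂γ = a := by
  have hO : IsOpen ((A ×ˢ A)ᶜ : Set (X × X)) := (hA.prod hA).isOpen_compl
  refine le_antisymm ?_ ?_
  · refine le_of_forall_gt_imp_ge_of_dense fun c hac => ?_
    exact h.lintegral_le hO (by simpa using h0) (g := fun z => φ z.1) (by fun_prop)
      ((ha.eventually_lt_const hac).mono fun n hn => hn.le)
  · obtain ⟨M, hM⟩ : ∃ M : ℝ≥0, ∀ z, φ z ≤ M := by
      obtain ⟨M, hM⟩ := (hc.isCompact_range hφ).bddAbove
      exact ⟨M, fun z => hM ⟨z, rfl⟩⟩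
    have key : ∀ k : ℕ, a ≤ ∫⁻ z, φ z.1 ∂γ + (M * C / ((k : ℝ≥0) + 1) ^ 2 : ℝ≥0) := by
      intro k
      have hk : (0 : ℝ≥0) < ((k : ℝ≥0) + 1) ^ 2 := by positivity
      -- Subtraction in `ℝ≥0` is truncated, so `ψ` vanishes once the distance reaches `k + 1`. Its
      -- support is then in a compact set because closed bounded sets in `X` are compact.
      set ψ : X × X → ℝ≥0 := fun z => φ z.1 * (1 - nndist z.1 z.2 ^ 2 / ((k : ℝ≥0) + 1) ^ 2) with hψ
      have hψc : Continuous ψ := by fun_prop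
      have hcomp : IsCompact (tsupport φ ×ˢ Metric.cthickening ((k : ℝ) + 1) (tsupport φ)) :=
        IsCompact.prod hc (IsCompact.cthickening hc)
      have hsub : Function.support ψ ⊆
          tsupport φ ×ˢ Metric.cthickening ((k : ℝ) + 1) (tsupport φ) := by
        intro z hz
        have hz' := hz
        simp only [hψ, Function.mem_support, ne_eq, mul_eq_zero, not_or] at hz'
        have h1 : z.1 ∈ tsupport φ := subset_tsupport φ hz'.1
        refine ⟨h1, Metric.mem_cthickening_of_dist_le z.2 z.1 _ _ h1 ?_⟩
        by_contra hlt
        push Not at hlt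
        apply hz'.2
        rw [tsub_eq_zero_iff_le, one_le_div hk]
        have : (k : ℝ≥0) + 1 ≤ nndist z.1 z.2 := by
          rw [← NNReal.coe_le_coe]
          push_cast
          rw [dist_comm] at hlt
          exact hlt.le
        gcongr
      have hlim := h ψ hψc (HasCompactSupport.of_support_subset_isCompact hcomp hsub)
        ((closure_minimal hsub hcomp.isClosed).trans fun z hz hzA => hs hz.1 hzA.1)
      have hle : ∀ n, ∫⁻ z, φ z.1 ∂γn n ≤
          ∫⁻ z, ψ z ∂γn n + (M * C / ((k : ℝ≥0) + 1) ^ 2 : ℝ≥0) := by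
        intro n
        calc ∫⁻ z, φ z.1 ∂γn n ≤ ∫⁻ z, ((ψ z : ℝ≥0∞) + ((M / ((k : ℝ≥0) + 1) ^ 2 : ℝ≥0) : ℝ≥0∞) *
              (nndist z.1 z.2 ^ 2 : ℝ≥0)) ∂γn n := by
              refine lintegral_mono fun z => ?_
              have : φ z.1 ≤ ψ z + M / ((k : ℝ≥0) + 1) ^ 2 * nndist z.1 z.2 ^ 2 := by
                have h1 : (1 : ℝ≥0) ≤ (1 - nndist z.1 z.2 ^ 2 / ((k : ℝ≥0) + 1) ^ 2) +
                  nndist z.1 z.2 ^ 2 / ((k : ℝ≥0) + 1) ^ 2 := le_tsub_add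
                calc φ z.1 = φ z.1 * 1 := (mul_one _).symm
                  _ ≤ φ z.1 * ((1 - nndist z.1 z.2 ^ 2 / ((k : ℝ≥0) + 1) ^ 2) +
                    nndist z.1 z.2 ^ 2 / ((k : ℝ≥0) + 1) ^ 2) := by gcongr
                  _ = ψ z + φ z.1 * (nndist z.1 z.2 ^ 2 / ((k : ℝ≥0) + 1) ^ 2) := by
                    rw [mul_add]
                  _ ≤ ψ z + M * (nndist z.1 z.2 ^ 2 / ((k : ℝ≥0) + 1) ^ 2) := by
                    gcongr
                    exact hM _
                  _ = _ := by ring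
              simpa only [ENNReal.coe_add, ENNReal.coe_mul] using ENNReal.coe_le_coe.2 this
          _ = ∫⁻ z, ψ z ∂γn n + ((M / ((k : ℝ≥0) + 1) ^ 2 : ℝ≥0) : ℝ≥0∞) * cost (γn n) := by
              rw [lintegral_add_left (by fun_prop), lintegral_const_mul _ measurable_nndist_sq]
              rfl
          _ ≤ ∫⁻ z, ψ z ∂γn n + ((M / ((k : ℝ≥0) + 1) ^ 2 : ℝ≥0) : ℝ≥0∞) * C := by
              gcongr
              exact hC n
          _ = _ := by
              rw [← ENNReal.coe_mul]
              congr 3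
              ring
      calc a ≤ ∫⁻ z, ψ z ∂γ + (M * C / ((k : ℝ≥0) + 1) ^ 2 : ℝ≥0) :=
            le_of_tendsto_of_tendsto' ha (hlim.add_const _) hle
        _ ≤ _ := by
            gcongr with z
            exact mul_le_of_le_one_right (by simp) tsub_le_self
    have ht : Tendsto (fun k : ℕ => ∫⁻ z, φ z.1 ∂γ + (M * C / ((k : ℝ≥0) + 1) ^ 2 : ℝ≥0)) atTop
        (𝓝 (∫⁻ z, φ z.1 ∂γ + ((0 : ℝ≥0) : ℝ≥0∞))) := by
      refine tendsto_const_nhds.add (ENNReal.tendsto_coe.2 ?_)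
      rw [← NNReal.tendsto_coe]
      push_cast
      refine tendsto_const_nhds.div_atTop ?_
      refine (tendsto_pow_atTop (by norm_num)).comp ?_
      exact tendsto_atTop_add_const_right _ _ tendsto_natCast_atTop_atTop
    simpa using ge_of_tendsto' ht key

/-- Compactness of plans and lower semicontinuity of the cost. -/
lemma exists_plan_of_vagueLim (hA : IsClosed A) (hne : A.Nonempty) (U : Ultrafilter ℕ)
    {μn νn : ℕ → Measure X} {μ ν : Measure X} {γn : ℕ → Measure (X × X)}
    (hγ : ∀ n, IsPlan b A (μn n) (νn n) (γn n)) {C M : ℝ≥0} (hC : ∀ n, cost (γn n) ≤ C)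
    (hμM : ∀ n, moment A (μn n) ≤ M) (hνM : ∀ n, moment A (νn n) ≤ M)
    (hμ : VagueLim U Aᶜ μn μ) (hν : VagueLim U Aᶜ νn ν) (hμ0 : μ A = 0) (hν0 : ν A = 0)
    (hμf : ∀ K ⊆ Aᶜ, IsCompact K → μ K < ∞) (hνf : ∀ K ⊆ Aᶜ, IsCompact K → ν K < ∞) :
    ∃ γ, IsPlan b A μ ν γ ∧ γ (A ×ˢ A) = 0 ∧
      ∀ c, (∀ᶠ n in (U : Filter ℕ), cost (γn n) ≤ c) → cost γ ≤ c := by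
  have hO : IsOpen ((A ×ˢ A)ᶜ : Set (X × X)) := (hA.prod hA).isOpen_compl
  have hfst : ∀ n, ∫⁻ z, (Metric.infNndist z.1 A ^ 2 : ℝ≥0) ∂γn n = moment A (μn n) := by
    intro n
    rw [← (hγ n).fst, moment_restrict_compl, moment_map _ measurable_fst]
  have hsnd : ∀ n, ∫⁻ z, (Metric.infNndist z.2 A ^ 2 : ℝ≥0) ∂γn n = moment A (νn n) := by
    intro n
    rw [← (hγ n).snd, moment_restrict_compl, moment_map _ measurable_snd]
  have hb : ∀ K ⊆ ((A ×ˢ A)ᶜ : Set (X × X)), IsCompact K → ∃ D : ℝ≥0, ∀ n, γn n K ≤ D := by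
    intro K hKO hK
    -- One of the two points of `z` may lie in `A` but not both, so the sum of the squared distances
    -- is positive on `K`; its integral is the sum of the two moments.
    obtain ⟨D, hD⟩ := exists_measure_le_mul_lintegral hK
      (w := fun z : X × X => Metric.infNndist z.1 A ^ 2 + Metric.infNndist z.2 A ^ 2)
      (by fun_prop) (by
        intro z hz
        by_cases h1 : z.1 ∈ A
        · have h2 : z.2 ∉ A := fun h2 => hKO hz ⟨h1, h2⟩
          have := infNndist_pos hA hne h2
          positivity
        · have := infNndist_pos hA hne h1
          positivity)
    refine ⟨D * (M + M), fun n => (hD _).trans ?_⟩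
    push_cast
    gcongr
    rw [lintegral_add_left (by fun_prop)]
    gcongr
    · exact (hfst n).trans_le (hμM n)
    · exact (hsnd n).trans_le (hνM n)
  obtain ⟨γ, hγ0, hγf, hlim⟩ := exists_vagueLim U hO γn hb
  have hm1 : moment A (γ.map Prod.fst) < ∞ := by
    rw [moment_map _ measurable_fst]
    refine (hlim.lintegral_le hO hγ0 (g := fun z => Metric.infNndist z.1 A ^ 2) (by fun_prop)
      (c := M) (Eventually.of_forall fun n => ?_)).trans_lt ENNReal.coe_lt_top
    exact (hfst n).trans_le (hμM n)
  have hm2 : moment A (γ.map Prod.snd) < ∞ := by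
    rw [moment_map _ measurable_snd]
    refine (hlim.lintegral_le hO hγ0 (g := fun z => Metric.infNndist z.2 A ^ 2) (by fun_prop)
      (c := M) (Eventually.of_forall fun n => ?_)).trans_lt ENNReal.coe_lt_top
    exact (hsnd n).trans_le (hνM n)
  have hγ0' : γ (A ×ˢ A) = 0 := by simpa using hγ0
  refine ⟨γ, ⟨?_, ?_, fun hb' => ?_⟩, hγ0', fun c hc => ?_⟩
  · rw [← Measure.restrict_eq_self_of_ae_mem (s := Aᶜ) (μ := μ)
      (measure_eq_zero_iff_ae_notMem.1 hμ0)]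
    refine restrict_eq_of_lintegral_eq hA.isOpen_compl
      (fun K hK hKc => measure_lt_top_of_moment hA hne hm1 hK hKc) hμf fun φ hφ hφc hφs => ?_
    rw [lintegral_map (by fun_prop) measurable_fst]
    refine lintegral_fst_eq_of_vagueLim hA hlim hγ0' hC hφ hφc hφs ?_
    refine (tendsto_congr fun n => ?_).1 (hμ φ hφ hφc hφs)
    rw [← (hγ n).fst, lintegral_restrict_compl hφs, lintegral_map (by fun_prop) measurable_fst]
  · rw [← Measure.restrict_eq_self_of_ae_mem (s := Aᶜ) (μ := ν)
      (measure_eq_zero_iff_ae_notMem.1 hν0)]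
    refine restrict_eq_of_lintegral_eq hA.isOpen_compl
      (fun K hK hKc => measure_lt_top_of_moment hA hne hm2 hK hKc) hνf fun φ hφ hφc hφs => ?_
    rw [lintegral_map (by fun_prop) measurable_snd]
    have := lintegral_fst_eq_of_vagueLim hA hlim.map_swap
      (by
        rw [Measure.map_apply measurable_swap (hA.prod hA).measurableSet, preimage_swap_prod]
        exact hγ0') (fun n => (cost_map_swap _).trans_le (hC n)) hφ hφc hφs
      (a := ∫⁻ x, φ x ∂ν) ?_
    · rw [← this, lintegral_map (by fun_prop) measurable_swap]
      rfl
    · refine (tendsto_congr fun n => ?_).1 (hν φ hφ hφc hφs)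
      rw [← (hγ n).snd, lintegral_restrict_compl hφs, lintegral_map (by fun_prop) measurable_snd,
        lintegral_map (by fun_prop) measurable_swap]
      rfl
  · exact hlim.isPointMeasure hO hγ0 hγf hb fun n => (hγ n).point hb'
  · exact hlim.lintegral_le hO hγ0 (g := fun z => nndist z.1 z.2 ^ 2) (by fun_prop) hc

end Plans

/-! ### The optimal cost: finiteness, minimisers, triangle inequality -/

section PlanCost

/-- Taking the least admissible index is measurable; this replaces measurable selection theorems
throughout. -/
lemma exists_measurable_nat {Z : Type*} [MeasurableSpace Z] (B : ℕ → Set Z)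
    (hB : ∀ k, MeasurableSet (B k)) :
    ∃ N : Z → ℕ, Measurable N ∧ ∀ z, (∃ k, z ∈ B k) → z ∈ B (N z) := by
  classical
  have hex : ∀ z, ∃ k, z ∈ B k ∨ ¬ ∃ k, z ∈ B k := by
    intro z
    by_cases h : ∃ k, z ∈ B k
    · exact ⟨h.choose, Or.inl h.choose_spec⟩
    · exact ⟨0, Or.inr h⟩
  refine ⟨fun z => Nat.find (hex z), measurable_find hex fun k => ?_, fun z hz => ?_⟩
  · have : {z | z ∈ B k ∨ ¬ ∃ k, z ∈ B k} = B k ∪ (⋃ k, B k)ᶜ := by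
      ext z
      simp
    rw [this]
    exact (hB k).union (MeasurableSet.iUnion hB).compl
  · exact (Nat.find_spec (hex z)).resolve_right (not_not.2 hz)

variable {X : Type*} [MetricSpace X] [MeasurableSpace X]

/-- The infimum of the cost over all plans between `μ` and `ν`. -/
noncomputable def planCost (b : Prop) (A : Set X) (μ ν : Measure X) : ℝ≥0∞ :=
  ⨅ (γ : Measure (X × X)) (_ : IsPlan b A μ ν γ), cost γ

variable {b : Prop} {A : Set X}

lemma planCost_le {μ ν : Measure X} {γ : Measure (X × X)} (h : IsPlan b A μ ν γ) :
    planCost b A μ ν ≤ cost γ := iInf₂_le γ h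

variable [BorelSpace X] [ProperSpace X]

lemma planCost_comm (μ ν : Measure X) : planCost b A μ ν = planCost b A ν μ := by
  have : ∀ μ ν : Measure X, planCost b A μ ν ≤ planCost b A ν μ := fun μ ν =>
    le_iInf₂ fun γ hγ => (planCost_le hγ.swap).trans_eq (cost_map_swap γ)
  exact le_antisymm (this _ _) (this _ _)

lemma restrict_compl_eq_self {μ : Measure X} (h : μ A = 0) :
    μ.restrict Aᶜ = μ :=
  Measure.restrict_eq_self_of_ae_mem (measure_eq_zero_iff_ae_notMem.1 h)

lemma planCost_self {μ : Measure X} (hμ : IsAdmissible b A μ) : planCost b A μ μ = 0 := by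
  have hp : IsPlan b A μ μ (μ.map fun x => (x, x)) := by
    refine ⟨?_, ?_, fun hb => (hμ.point hb).map (by fun_prop)⟩
    · rw [Measure.map_map measurable_fst (by fun_prop)]
      exact (congrArg _ Measure.map_id).trans (restrict_compl_eq_self hμ.null)
    · rw [Measure.map_map measurable_snd (by fun_prop)]
      exact (congrArg _ Measure.map_id).trans (restrict_compl_eq_self hμ.null)
  refine le_antisymm ((planCost_le hp).trans_eq ?_) zero_le
  rw [cost_map _ (by fun_prop)]
  simp

lemma exists_measurable_projection (hA : IsClosed A) (hne : A.Nonempty) :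
    ∃ a : X → X, Measurable a ∧ (∀ x, a x ∈ A) ∧
      ∀ x ∉ A, nndist x (a x) ≤ 2 * Metric.infNndist x A := by
  have : Nonempty A := hne.to_subtype
  let d := TopologicalSpace.denseSeq A
  obtain ⟨N, hN, hNs⟩ := exists_measurable_nat
    (fun k => {x : X | nndist x (d k) ≤ 2 * Metric.infNndist x A}) fun k =>
      measurableSet_le (by fun_prop) (by fun_prop)
  refine ⟨fun x => d (N x), ?_, fun x => (d (N x)).2, fun x hx => hNs x ?_⟩
  · exact (measurable_from_nat (f := fun k => (d k : X))).comp hN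
  · have hpos := infNndist_pos hA hne hx
    have hpos' : 0 < Metric.infDist x A := hpos
    -- The factor `2` is split as `3 / 2` for a near-minimiser in `A` and `1 / 2` for its
    -- approximation by the dense sequence.
    obtain ⟨y, hy, hxy⟩ := (Metric.infDist_lt_iff hne (x := x) (r := 3 / 2 * Metric.infDist x A)).1
      (by linarith)
    obtain ⟨k, hk⟩ := (TopologicalSpace.denseRange_denseSeq A).exists_dist_lt (⟨y, hy⟩ : A)
      (ε := 1 / 2 * Metric.infDist x A) (by linarith)
    refine ⟨k, ?_⟩
    have h1 : dist x (d k) ≤ 2 * Metric.infDist x A := by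
      have h2 : dist y (d k) < 1 / 2 * Metric.infDist x A := hk
      linarith [dist_triangle x y (d k)]
    exact h1

lemma planCost_lt_top (hA : IsClosed A) (hne : A.Nonempty) {μ ν : Measure X}
    (hμ : IsAdmissible b A μ) (hν : IsAdmissible b A ν) : planCost b A μ ν < ∞ := by
  obtain ⟨a, ha, haA, had⟩ := exists_measurable_projection hA hne
  have hz : ∀ m : Measure X, (m.map a).restrict Aᶜ = 0 := by
    intro m
    rw [Measure.restrict_eq_zero, Measure.map_apply ha hA.measurableSet.compl]
    convert! measure_empty (μ := m)
    ext x
    simp [haA x]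
  -- Send all of `μ` into `A` and bring all of `ν` out of `A`. The cost is at most four times the
  -- sum of the moments.
  have hp : IsPlan b A μ ν (μ.map (fun x => (x, a x)) + ν.map (fun y => (a y, y))) := by
    refine ⟨?_, ?_, fun hb => ((hμ.point hb).map (by fun_prop)).add
      ((hν.point hb).map (by fun_prop))⟩
    · rw [Measure.map_add _ _ measurable_fst, Measure.map_map measurable_fst (by fun_prop),
        Measure.map_map measurable_fst (by fun_prop), Measure.restrict_add]
      change (μ.map id).restrict Aᶜ + (ν.map a).restrict Aᶜ = μ
      rw [hz, Measure.map_id, restrict_compl_eq_self hμ.null, add_zero]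
    · rw [Measure.map_add _ _ measurable_snd, Measure.map_map measurable_snd (by fun_prop),
        Measure.map_map measurable_snd (by fun_prop), Measure.restrict_add]
      change (μ.map a).restrict Aᶜ + (ν.map id).restrict Aᶜ = ν
      rw [hz, Measure.map_id, restrict_compl_eq_self hν.null, zero_add]
  have hcost : ∀ m : Measure X, m A = 0 →
      ∫⁻ x, (nndist x (a x) ^ 2 : ℝ≥0) ∂m ≤ 4 * moment A m := by
    intro m hm
    rw [moment, ← lintegral_const_mul _ (by fun_prop)]
    refine lintegral_mono_ae ?_
    filter_upwards [measure_eq_zero_iff_ae_notMem.1 hm] with x hx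
    have h1 : nndist x (a x) ^ 2 ≤ 4 * Metric.infNndist x A ^ 2 :=
      (pow_le_pow_left₀ (by simp) (had x hx) 2).trans_eq (by ring)
    exact_mod_cast ENNReal.coe_le_coe.2 h1
  refine (planCost_le hp).trans_lt ?_
  have e : cost (μ.map (fun x => (x, a x)) + ν.map (fun y => (a y, y))) =
      cost (μ.map (fun x => (x, a x))) + cost (ν.map (fun y => (a y, y))) :=
    lintegral_add_measure _ _ _
  rw [e, cost_map _ (by fun_prop), cost_map _ (by fun_prop)]
  refine ENNReal.add_lt_top.2 ⟨(hcost μ hμ.null).trans_lt ?_, ?_⟩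
  · exact ENNReal.mul_lt_top (by simp) hμ.moment_lt_top
  · simp_rw [nndist_comm (a _)]
    exact (hcost ν hν.null).trans_lt (ENNReal.mul_lt_top (by simp) hν.moment_lt_top)

lemma exists_admissible_vagueLim (hA : IsClosed A) (hne : A.Nonempty) (U : Ultrafilter ℕ)
    {μn : ℕ → Measure X} (hμ : ∀ n, IsAdmissible b A (μn n)) {M : ℝ≥0}
    (hM : ∀ n, moment A (μn n) ≤ M) :
    ∃ μ, IsAdmissible b A μ ∧ VagueLim U Aᶜ μn μ ∧ moment A μ ≤ M := by
  have hb : ∀ K ⊆ Aᶜ, IsCompact K → ∃ C : ℝ≥0, ∀ n, μn n K ≤ C := fun K hK hKc =>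
    exists_measure_le_of_moment_le hA hne hM hK hKc
  obtain ⟨μ, h0, hf, hlim⟩ := exists_vagueLim U hA.isOpen_compl μn hb
  have hm : moment A μ ≤ M := hlim.lintegral_le hA.isOpen_compl h0
    (g := fun x => Metric.infNndist x A ^ 2) (by fun_prop) (Eventually.of_forall hM)
  refine ⟨μ, ⟨by simpa using h0, hm.trans_lt ENNReal.coe_lt_top, fun hb' => ?_⟩, hlim, hm⟩
  exact hlim.isPointMeasure hA.isOpen_compl h0 hf hb fun n => (hμ n).point hb'

lemma exists_plan_cost_le_of_vagueLim (hA : IsClosed A) (hne : A.Nonempty) (U : Ultrafilter ℕ)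
    {μn νn : ℕ → Measure X} {μ ν : Measure X}
    (hμ : IsAdmissible b A μ) (hν : IsAdmissible b A ν) {M : ℝ≥0}
    (hμM : ∀ n, moment A (μn n) ≤ M) (hνM : ∀ n, moment A (νn n) ≤ M)
    (hμl : VagueLim U Aᶜ μn μ) (hνl : VagueLim U Aᶜ νn ν) {c : ℕ → ℝ≥0} {c₀ : ℝ≥0}
    (hc : Tendsto c U (𝓝 c₀)) (hcM : ∀ n, c n ≤ M)
    (h : ∀ n, ∃ γ, IsPlan b A (μn n) (νn n) γ ∧ cost γ ≤ c n) :
    ∃ γ, IsPlan b A μ ν γ ∧ γ (A ×ˢ A) = 0 ∧ cost γ ≤ c₀ := by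
  choose γn hγn hcost using h
  obtain ⟨γ, hγ, hγ0, hγc⟩ := exists_plan_of_vagueLim hA hne U hγn
    (fun n => (hcost n).trans (ENNReal.coe_le_coe.2 (hcM n))) hμM hνM hμl hνl hμ.null hν.null
    (fun K hK hKc => measure_lt_top_of_moment hA hne hμ.moment_lt_top hK hKc)
    (fun K hK hKc => measure_lt_top_of_moment hA hne hν.moment_lt_top hK hKc)
  refine ⟨γ, hγ, hγ0, le_of_forall_gt_imp_ge_of_dense fun d hd => hγc d ?_⟩
  filter_upwards [(ENNReal.tendsto_coe.2 hc).eventually_lt_const hd] with n hn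
  exact (hcost n).trans hn.le

lemma exists_nnreal_eq {a : ℝ≥0∞} (ha : a ≠ ∞) : ∃ c : ℝ≥0, (c : ℝ≥0∞) = a :=
  ⟨_, ENNReal.coe_toNNReal ha⟩

/-- The direct method: a vague ultralimit of a minimising sequence. The plan obtained has no mass on
`A × A`, as needed for plans living on `E_Ω`. -/
lemma exists_optimal_plan (hA : IsClosed A) (hne : A.Nonempty) {μ ν : Measure X}
    (hμ : IsAdmissible b A μ) (hν : IsAdmissible b A ν) :
    ∃ γ, IsPlan b A μ ν γ ∧ γ (A ×ˢ A) = 0 ∧ cost γ = planCost b A μ ν := by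
  have hfin := planCost_lt_top hA hne hμ hν
  obtain ⟨c₀, hc₀⟩ := exists_nnreal_eq hfin.ne
  obtain ⟨m, hm⟩ := exists_nnreal_eq hμ.moment_lt_top.ne
  obtain ⟨m', hm'⟩ := exists_nnreal_eq hν.moment_lt_top.ne
  have hlim : Tendsto (fun n : ℕ => c₀ + 1 / ((n : ℝ≥0) + 1)) (hyperfilter ℕ) (𝓝 (c₀ + 0)) := by
    refine Tendsto.mono_left (tendsto_const_nhds.add ?_) Nat.hyperfilter_le_atTop
    exact tendsto_one_div_add_atTop_nhds_zero_nat
  rw [add_zero] at hlim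
  obtain ⟨γ, hγ, hγ0, hγc⟩ := exists_plan_cost_le_of_vagueLim (μn := fun _ => μ) (νn := fun _ => ν)
    -- A single constant must dominate both moments and all the costs `c₀ + 1 / (n + 1)`.
    (M := m + m' + (c₀ + 1)) hA hne (hyperfilter ℕ) hμ hν
    (fun n => hm ▸ by
      exact_mod_cast ENNReal.coe_le_coe.2 (by rw [add_assoc]; exact le_self_add))
    (fun n => hm' ▸ by
      exact_mod_cast ENNReal.coe_le_coe.2 (le_add_right le_add_self))
    (fun f _ _ _ => tendsto_const_nhds) (fun f _ _ _ => tendsto_const_nhds)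
    hlim (fun n => by
      refine le_add_left (add_le_add_right ?_ _)
      rw [div_le_one (by positivity)]
      exact le_add_self)
    (fun n => by
      have hlt : planCost b A μ ν < ((c₀ + 1 / ((n : ℝ≥0) + 1) : ℝ≥0) : ℝ≥0∞) := by
        rw [← hc₀, ENNReal.coe_lt_coe]
        exact lt_add_of_pos_right _ (by positivity)
      obtain ⟨γ, hγ⟩ := iInf_lt_iff.1 hlt
      obtain ⟨hp, hγ⟩ := iInf_lt_iff.1 hγ
      exact ⟨γ, hp, hγ.le⟩)
  exact ⟨γ, hγ, hγ0, le_antisymm (hγc.trans hc₀.le) (planCost_le hγ)⟩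

lemma eq_of_planCost_eq_zero (hA : IsClosed A) (hne : A.Nonempty) {μ ν : Measure X}
    (hμ : IsAdmissible b A μ) (hν : IsAdmissible b A ν) (h : planCost b A μ ν = 0) : μ = ν := by
  obtain ⟨γ, hγ, -, hc⟩ := exists_optimal_plan hA hne hμ hν
  rw [h, cost, lintegral_eq_zero_iff measurable_nndist_sq] at hc
  rw [← hγ.fst, ← hγ.snd]
  congr 1
  refine Measure.map_congr ?_
  filter_upwards [hc] with z hz
  simpa using hz

/-- Two measures on `X × X` which differ by a measure on the diagonal of `A × A`. -/
def EqUpToDiag (A : Set X) (γ' γ : Measure (X × X)) : Prop :=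
  ∃ m : Measure X, m Aᶜ = 0 ∧ γ' = γ + m.map fun x => (x, x)

lemma EqUpToDiag.cost_eq {γ' γ : Measure (X × X)} (h : EqUpToDiag A γ' γ) : cost γ' = cost γ := by
  obtain ⟨m, -, rfl⟩ := h
  have e : cost (m.map fun x : X => (x, x)) = 0 := by
    rw [cost_map _ (by fun_prop)]
    simp
  have := lintegral_add_measure (fun z : X × X => ((nndist z.1 z.2 ^ 2 : ℝ≥0) : ℝ≥0∞)) γ
    (m.map fun x => (x, x))
  change cost _ = cost _ + cost _ at this
  rw [this, e, add_zero]

lemma EqUpToDiag.map_fst {γ' γ : Measure (X × X)} (h : EqUpToDiag A γ' γ) :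
    (γ'.map Prod.fst).restrict Aᶜ = (γ.map Prod.fst).restrict Aᶜ := by
  obtain ⟨m, hm, rfl⟩ := h
  rw [Measure.map_add _ _ measurable_fst, Measure.map_map measurable_fst (by fun_prop),
    Measure.restrict_add]
  change _ + (m.map id).restrict Aᶜ = _
  rw [Measure.map_id, Measure.restrict_eq_zero.2 hm, add_zero]

lemma EqUpToDiag.map_snd {γ' γ : Measure (X × X)} (h : EqUpToDiag A γ' γ) :
    (γ'.map Prod.snd).restrict Aᶜ = (γ.map Prod.snd).restrict Aᶜ := by
  obtain ⟨m, hm, rfl⟩ := h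
  rw [Measure.map_add _ _ measurable_snd, Measure.map_map measurable_snd (by fun_prop),
    Measure.restrict_add]
  change _ + (m.map id).restrict Aᶜ = _
  rw [Measure.map_id, Measure.restrict_eq_zero.2 hm, add_zero]

lemma EqUpToDiag.trans {γ'' γ' γ : Measure (X × X)} (h : EqUpToDiag A γ'' γ')
    (h' : EqUpToDiag A γ' γ) : EqUpToDiag A γ'' γ := by
  obtain ⟨m, hm, rfl⟩ := h
  obtain ⟨m', hm', rfl⟩ := h'
  refine ⟨m' + m, by simp [hm, hm'], ?_⟩
  rw [Measure.map_add _ _ (by fun_prop), add_assoc]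

lemma eqUpToDiag_add (hA : IsClosed A) {Y : Type*} [MeasurableSpace Y] (γ : Measure (X × X))
    (Γ : Measure (X × Y)) : EqUpToDiag A
      (γ + (Γ.restrict (Prod.fst ⁻¹' Aᶜᶜ)).map fun z => (z.1, z.1)) γ := by
  refine ⟨(Γ.restrict (Prod.fst ⁻¹' Aᶜᶜ)).map Prod.fst, ?_, ?_⟩
  · rw [map_fst_restrict _ hA.measurableSet.compl.compl,
      Measure.restrict_apply hA.measurableSet.compl]
    simp
  · rw [Measure.map_map (by fun_prop) measurable_fst]
    rfl

/-- Plans from a common measure can be glued together. -/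
lemma exists_star (hA : IsClosed A) (hne : A.Nonempty) {x p q r : Measure X}
    (hx : IsAdmissible b A x) {γp γq γr : Measure (X × X)} (hp : IsPlan b A x p γp)
    (hq : IsPlan b A x q γq) (hr : IsPlan b A x r γr) :
    ∃ Θ : Measure (X × ((X × X) × X)), (b → IsPointMeasure Θ) ∧
      EqUpToDiag A (Θ.map fun z => (z.1, z.2.1.1)) γp ∧
      EqUpToDiag A (Θ.map fun z => (z.1, z.2.1.2)) γq ∧
      EqUpToDiag A (Θ.map fun z => (z.1, z.2.2)) γr := by
  have : Nonempty X := hne.to_type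
  have hw : Measurable fun x : X => ((Metric.infNndist x A ^ 2 : ℝ≥0) : ℝ≥0∞) :=
    measurable_infNndist_sq
  have hw0 : ∀ x ∈ Aᶜ, ((Metric.infNndist x A ^ 2 : ℝ≥0) : ℝ≥0∞) ≠ 0 := fun x hx => by
    exact_mod_cast (pow_pos (infNndist_pos hA hne hx) 2).ne'
  have hmom : ∫⁻ y in Aᶜ, ((Metric.infNndist y A ^ 2 : ℝ≥0) : ℝ≥0∞) ∂(γp.map Prod.fst) < ∞ := by
    rw [hp.fst]
    exact hx.moment_lt_top
  -- The filling maps are identities, so mass over `A` that has no partner stays put and only adds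
  -- measure on the diagonal of `A × A`.
  obtain ⟨Θ₁, hΘp, h1, h2⟩ := exists_glue b hp.point hq.point hA.measurableSet.compl
    (hp.fst.trans hq.fst.symm) hw hw0 (fun _ => ENNReal.coe_ne_top) hmom measurable_id measurable_id
  simp only [id] at h1 h2
  have d1 : EqUpToDiag A (Θ₁.map fun z => (z.1, z.2.1)) γp := h1 ▸ eqUpToDiag_add hA _ _
  have d2 : EqUpToDiag A (Θ₁.map fun z => (z.1, z.2.2)) γq := h2 ▸ eqUpToDiag_add hA _ _
  have h3 : (Θ₁.map Prod.fst).restrict Aᶜ = x := by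
    have := d1.map_fst
    rw [Measure.map_map measurable_fst (by fun_prop), hp.fst] at this
    exact this
  obtain ⟨Θ, hΘ, h4, h5⟩ := exists_glue b hΘp hr.point hA.measurableSet.compl
    (h3.trans hr.fst.symm) hw hw0 (fun _ => ENNReal.coe_ne_top) (by
      rw [h3]
      exact hx.moment_lt_top) (ψ := fun x => (x, x)) (ψ' := id) (by fun_prop) measurable_id
  simp only [id] at h5
  refine ⟨Θ, hΘ, ?_, ?_, h5 ▸ eqUpToDiag_add hA _ _⟩
  · refine EqUpToDiag.trans (γ' := Θ₁.map fun z => (z.1, z.2.1)) ?_ d1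
    have := congrArg (fun m : Measure (X × (X × X)) => m.map fun z => (z.1, z.2.1)) h4
    rw [Measure.map_map (by fun_prop) (by fun_prop), Measure.map_add _ _ (by fun_prop),
      Measure.map_map (by fun_prop) (by fun_prop)] at this
    exact this ▸ eqUpToDiag_add hA _ _
  · refine EqUpToDiag.trans (γ' := Θ₁.map fun z => (z.1, z.2.2)) ?_ d2
    have := congrArg (fun m : Measure (X × (X × X)) => m.map fun z => (z.1, z.2.2)) h4
    rw [Measure.map_map (by fun_prop) (by fun_prop), Measure.map_add _ _ (by fun_prop),
      Measure.map_map (by fun_prop) (by fun_prop)] at this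
    exact this ▸ eqUpToDiag_add hA _ _

/-- Random variables with the right marginals give an upper bound for the optimal cost. -/
lemma planCost_le_lintegral {Z : Type*} [MeasurableSpace Z] {Θ : Measure Z}
    (hΘ : b → IsPointMeasure Θ) {μ ν : Measure X} {f g : Z → X} (hf : Measurable f)
    (hg : Measurable g) (hμ : (Θ.map f).restrict Aᶜ = μ) (hν : (Θ.map g).restrict Aᶜ = ν) :
    planCost b A μ ν ≤ ∫⁻ z, (nndist (f z) (g z) ^ 2 : ℝ≥0) ∂Θ := by
  have hp : IsPlan b A μ ν (Θ.map fun z => (f z, g z)) := by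
    refine ⟨?_, ?_, fun hb => (hΘ hb).map (by fun_prop)⟩
    · rw [Measure.map_map measurable_fst (by fun_prop)]
      exact hμ
    · rw [Measure.map_map measurable_snd (by fun_prop)]
      exact hν
  exact (planCost_le hp).trans_eq (cost_map _ (by fun_prop))

lemma EqUpToDiag.map_eq {Z : Type*} [MeasurableSpace Z] {Θ : Measure Z} {f g : Z → X}
    (hf : Measurable f) (hg : Measurable g) {γ : Measure (X × X)} {μ ν : Measure X}
    (h : EqUpToDiag A (Θ.map fun z => (f z, g z)) γ) (hγ : IsPlan b A μ ν γ) :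
    (Θ.map g).restrict Aᶜ = ν ∧ ∫⁻ z, (nndist (f z) (g z) ^ 2 : ℝ≥0) ∂Θ = cost γ := by
  have h1 := h.map_snd
  have h2 := h.cost_eq
  rw [cost_map _ (by fun_prop)] at h2
  rw [Measure.map_map measurable_snd (by fun_prop), hγ.snd] at h1
  exact ⟨h1, h2⟩

/-- Glue optimal plans at the middle measure `ν` and apply Minkowski's inequality in `L²` of the
gluing. -/
lemma planCost_rpow_triangle (hA : IsClosed A) (hne : A.Nonempty) {μ ν ρ : Measure X}
    (hμ : IsAdmissible b A μ) (hν : IsAdmissible b A ν) (hρ : IsAdmissible b A ρ) :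
    planCost b A μ ρ ^ (1 / 2 : ℝ) ≤
      planCost b A μ ν ^ (1 / 2 : ℝ) + planCost b A ν ρ ^ (1 / 2 : ℝ) := by
  obtain ⟨γ₁, h₁, -, hc₁⟩ := exists_optimal_plan hA hne hν hμ
  obtain ⟨γ₂, h₂, -, hc₂⟩ := exists_optimal_plan hA hne hν hρ
  -- Only two legs are needed; the third is a dummy copy.
  obtain ⟨Θ, hΘ, d₁, d₂, -⟩ := exists_star hA hne hν h₁ h₂ h₂
  obtain ⟨m₁, e₁⟩ := d₁.map_eq (by fun_prop) (by fun_prop) h₁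
  obtain ⟨m₂, e₂⟩ := d₂.map_eq (by fun_prop) (by fun_prop) h₂
  have key := planCost_le_lintegral hΘ (f := fun z => z.2.1.1) (g := fun z => z.2.1.2)
    (by fun_prop) (by fun_prop) m₁ m₂
  rw [planCost_comm μ ν, ← hc₁, ← hc₂, ← e₁, ← e₂]
  refine (ENNReal.rpow_le_rpow key (by norm_num)).trans ?_
  have mink := ENNReal.lintegral_Lp_add_le (μ := Θ) (p := 2)
    (f := fun z : X × ((X × X) × X) => (nndist z.1 z.2.1.1 : ℝ≥0∞))
    (g := fun z => (nndist z.1 z.2.1.2 : ℝ≥0∞)) (by fun_prop) (by fun_prop) (by norm_num)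
  refine le_trans (ENNReal.rpow_le_rpow (lintegral_mono fun z => ?_) (by norm_num))
    (mink.trans_eq ?_)
  · have : nndist z.2.1.1 z.2.1.2 ≤ nndist z.1 z.2.1.1 + nndist z.1 z.2.1.2 :=
      nndist_triangle_left _ _ _
    simp only [Pi.add_apply, ENNReal.rpow_two]
    have := ENNReal.coe_le_coe.2 (pow_le_pow_left₀ (by simp) this 2)
    simpa using this
  · simp

end PlanCost

/-! ### Geodesics and triangle comparison in a metric space -/

section Comparison

variable {Y : Type*} [MetricSpace Y]

/-- The upper bounds on `[0, s]`, `[s, t]`, `[t, 1]` add up to the distance of the endpoints, so by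
the triangle inequality each is an equality. -/
lemma isGeodesic_of_dist_le {ξ : unitInterval → Y}
    (h : ∀ s t : unitInterval, s ≤ t → dist (ξ s) (ξ t) ≤ ((t : ℝ) - s) * dist (ξ 0) (ξ 1)) :
    IsGeodesic ξ := by
  have key : ∀ s t : unitInterval, s ≤ t →
      dist (ξ s) (ξ t) = dist (ξ 0) (ξ 1) * |(s : ℝ) - (t : ℝ)| := by
    intro s t hst
    have h1 := h 0 s s.2.1
    have h2 := h s t hst
    have h3 := h t 1 t.2.2
    have h4 := dist_triangle4 (ξ 0) (ξ s) (ξ t) (ξ 1)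
    have h5 : (s : ℝ) ≤ t := hst
    rw [abs_sub_comm, abs_of_nonneg (by linarith)]
    simp only [Set.Icc.coe_zero, Set.Icc.coe_one] at h1 h3
    linarith
  intro s t
  rcases le_total s t with hst | hst
  · exact key s t hst
  · rw [dist_comm, key t s hst, abs_sub_comm]

lemma exists_comparison_triangle (p q r : Y) : ∃ p' q' r' : EuclideanSpace ℝ (Fin 2),
    dist p' q' = dist p q ∧ dist q' r' = dist q r ∧ dist r' p' = dist r p := by
  rcases eq_or_ne q r with rfl | hqr
  · refine ⟨!₂[dist p q, 0], !₂[0, 0], !₂[0, 0], ?_, ?_, ?_⟩ <;>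
      simp [EuclideanSpace.dist_eq, Real.sqrt_sq, dist_comm]
  set a := dist p q
  set c := dist q r with hc
  set b := dist r p
  have hc0 : 0 < c := dist_pos.2 hqr
  have ha : 0 ≤ a := dist_nonneg
  have hb : 0 ≤ b := dist_nonneg
  have h1 : a ≤ b + c := by
    have := dist_triangle_right p q r
    rw [dist_comm p r] at this
    exact this
  have h2 : b ≤ a + c := by
    have := dist_triangle r q p
    rw [dist_comm r q, dist_comm q p] at this
    linarith
  have h3 : c ≤ a + b := by
    have := dist_triangle q p r
    rw [dist_comm q p, dist_comm p r] at this
    linarith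
  -- The law of cosines: `u` is the coordinate of the foot of the altitude from `p'` when `q' = 0`
  -- and `r' = (c, 0)`.
  set u := (a ^ 2 + c ^ 2 - b ^ 2) / (2 * c) with hu
  have hu' : u * (2 * c) = a ^ 2 + c ^ 2 - b ^ 2 := by
    rw [hu]
    field_simp
  have hua : u ^ 2 ≤ a ^ 2 := by
    have hx : (u * (2 * c)) ^ 2 ≤ (a * (2 * c)) ^ 2 := by
      rw [hu']
      -- Heron's factorisation, whose factors are nonnegative by the triangle inequalities.
      have e : (a * (2 * c)) ^ 2 - (a ^ 2 + c ^ 2 - b ^ 2) ^ 2 =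
        ((b + c - a) * (a + b - c)) * ((a + c - b) * (a + b + c)) := by ring
      have : 0 ≤ ((b + c - a) * (a + b - c)) * ((a + c - b) * (a + b + c)) :=
        mul_nonneg (mul_nonneg (by linarith) (by linarith))
          (mul_nonneg (by linarith) (by linarith))
      linarith
    rw [mul_pow u, mul_pow a] at hx
    exact le_of_mul_le_mul_right hx (by positivity)
  refine ⟨!₂[u, Real.sqrt (a ^ 2 - u ^ 2)], !₂[0, 0], !₂[c, 0], ?_, ?_, ?_⟩
  · simp only [EuclideanSpace.dist_eq, Fin.sum_univ_two, Real.dist_eq, sq_abs]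
    simp [Real.sq_sqrt (sub_nonneg.2 hua), Real.sqrt_sq ha]
  · simp only [EuclideanSpace.dist_eq, Fin.sum_univ_two, Real.dist_eq, sq_abs]
    simp [Real.sqrt_sq hc0.le]
  · simp only [EuclideanSpace.dist_eq, Fin.sum_univ_two, Real.dist_eq, sq_abs]
    have e : (c - u) ^ 2 + (a ^ 2 - u ^ 2) = b ^ 2 := by linarith
    simp only [Matrix.cons_val_zero, Matrix.cons_val_one, zero_sub, even_two,
      Even.neg_pow, Real.sq_sqrt (sub_nonneg.2 hua)]
    rw [e, Real.sqrt_sq hb]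

/-- Stewart's identity: the comparison inequality below is an equality in Euclidean space. -/
lemma dist_sq_lineMap {V : Type*} [NormedAddCommGroup V] [InnerProductSpace ℝ V] (p q r : V)
    (t : ℝ) : dist p ((1 - t) • q + t • r) ^ 2 =
      (1 - t) * dist p q ^ 2 + t * dist p r ^ 2 - t * (1 - t) * dist q r ^ 2 := by
  have e1 : p - ((1 - t) • q + t • r) = (1 - t) • (p - q) + t • (p - r) := by
    module
  have e2 : q - r = (p - r) - (p - q) := by abel
  rw [dist_eq_norm, dist_eq_norm, dist_eq_norm, dist_eq_norm, e1, e2]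
  generalize p - q = v, p - r = w
  rw [norm_add_sq_real, norm_sub_sq_real, norm_smul, norm_smul, inner_smul_left, inner_smul_right,
    mul_pow, mul_pow,
    real_inner_comm]
  simp only [Real.norm_eq_abs, sq_abs, conj_trivial]
  ring

/-- Triangle comparison in terms of squared distances. -/
lemma triangleComparison_iff : TriangleComparison Y ↔
    ∀ (p : Y) (ξ : unitInterval → Y), IsGeodesic ξ → ∀ t : unitInterval,
      (1 - (t : ℝ)) * dist p (ξ 0) ^ 2 + t * dist p (ξ 1) ^ 2 ≤
        dist p (ξ t) ^ 2 + t * (1 - t) * dist (ξ 0) (ξ 1) ^ 2 := by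
  constructor
  · intro h p ξ hξ t
    obtain ⟨p', q', r', h1, h2, h3⟩ := exists_comparison_triangle p (ξ 0) (ξ 1)
    have hx' : (1 - (t : ℝ)) • q' + (t : ℝ) • r' ∈ segment ℝ q' r' :=
      ⟨1 - t, t, by linarith [t.2.2], t.2.1, by ring, rfl⟩
    have hd : dist q' ((1 - (t : ℝ)) • q' + (t : ℝ) • r') = dist (ξ 0) (ξ t) := by
      have e : q' - ((1 - (t : ℝ)) • q' + (t : ℝ) • r') = (t : ℝ) • (q' - r') := by module
      rw [hξ 0 t, ← h2, dist_eq_norm, e, norm_smul, dist_eq_norm]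
      simp [mul_comm]
    have := h p (ξ 0) (ξ 1) ξ hξ rfl rfl p' q' r' h1 h2 h3 t _ hx' hd
    have hsq := pow_le_pow_left₀ dist_nonneg this 2
    rw [dist_sq_lineMap, h1, h2, dist_comm p' r', h3, dist_comm (ξ 1) p] at hsq
    linarith
  · rintro h p q r ξ hξ rfl rfl p' q' r' h1 h2 h3 t x' ⟨s', s, hs', hs, hss, rfl⟩ hd
    obtain rfl : s' = 1 - s := by linarith
    have e : q' - ((1 - s) • q' + s • r') = s • (q' - r') := by module
    rw [hξ 0 t, dist_eq_norm, e, norm_smul, ← dist_eq_norm, h2] at hd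
    simp only [Set.Icc.coe_zero, zero_sub, abs_neg, Real.norm_eq_abs, abs_of_nonneg hs,
      abs_of_nonneg t.2.1] at hd
    refine le_of_sq_le_sq ?_ dist_nonneg
    have h4 := h p ξ hξ t
    rw [dist_sq_lineMap, h1, h2, dist_comm p' r', h3, dist_comm (ξ 1) p]
    -- On a constant geodesic the distance does not determine the parameter `s`, but then the
    -- inequality does not depend on it either.
    rcases eq_or_ne (ξ 0) (ξ 1) with h5 | h5
    · rw [← h5] at h4 ⊢
      simp only [dist_self] at h4 ⊢
      rw [dist_comm] at *
      nlinarith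
    · have : s = t := by
        have := dist_pos.2 h5
        rw [mul_comm] at hd
        exact mul_left_cancel₀ this.ne' hd
      rw [this]
      linarith

/-- In a geodesic space, a point which divides the distance between two points lies on a
geodesic. -/
lemma exists_geodesic_through (hY : IsGeodesicSpace Y) {q x r : Y} {t : unitInterval}
    (ht0 : 0 < (t : ℝ)) (ht1 : (t : ℝ) < 1) (hq : dist q x = t * dist q r)
    (hr : dist x r = (1 - t) * dist q r) :
    ∃ ξ : unitInterval → Y, IsGeodesic ξ ∧ ξ 0 = q ∧ ξ t = x ∧ ξ 1 = r := by
  obtain ⟨ξ₁, h₁, h₁0, h₁1⟩ := hY q x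
  obtain ⟨ξ₂, h₂, h₂0, h₂1⟩ := hY x r
  have ht1' : 0 < 1 - (t : ℝ) := by linarith
  let f₁ : unitInterval → unitInterval := fun s => projIcc 0 1 zero_le_one ((s : ℝ) / t)
  let f₂ : unitInterval → unitInterval := fun s => projIcc 0 1 zero_le_one (((s : ℝ) - t) / (1 - t))
  have hf₁ : ∀ s ≤ t, (f₁ s : ℝ) = s / t := by
    intro s hs
    have hs' : (s : ℝ) ≤ t := hs
    refine congrArg Subtype.val (projIcc_of_mem zero_le_one ⟨?_, ?_⟩)
    · exact div_nonneg s.2.1 ht0.le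
    · exact (div_le_one ht0).2 hs'
  have hf₂ : ∀ s, t ≤ s → (f₂ s : ℝ) = (s - t) / (1 - t) := by
    intro s hs
    have hs' : (t : ℝ) ≤ s := hs
    refine congrArg Subtype.val (projIcc_of_mem zero_le_one ⟨?_, ?_⟩)
    · exact div_nonneg (by linarith) ht1'.le
    · exact (div_le_one ht1').2 (by linarith [s.2.2])
  classical
  let ξ : unitInterval → Y := fun s => if s ≤ t then ξ₁ (f₁ s) else ξ₂ (f₂ s)
  have hft : f₁ t = 1 := by
    apply Subtype.ext
    rw [hf₁ t le_rfl, div_self ht0.ne']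
    rfl
  have hft' : f₂ t = 0 := by
    apply Subtype.ext
    rw [hf₂ t le_rfl, sub_self, zero_div]
    rfl
  have hξ₁ : ∀ s ≤ t, ξ s = ξ₁ (f₁ s) := fun s hs => if_pos hs
  have hξ₂ : ∀ s, t ≤ s → ξ s = ξ₂ (f₂ s) := by
    intro s hs
    rcases hs.eq_or_lt with rfl | hs
    · rw [hξ₁ _ le_rfl, hft, h₁1, hft', h₂0]
    · exact if_neg (not_le.2 hs)
  have hξ0 : ξ 0 = q := by
    rw [hξ₁ 0 t.2.1, ← h₁0]
    congr 1
    apply Subtype.ext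
    rw [hf₁ 0 t.2.1]
    simp
  have hξ1 : ξ 1 = r := by
    rw [hξ₂ 1 t.2.2, ← h₂1]
    congr 1
    apply Subtype.ext
    rw [hf₂ 1 t.2.2]
    exact div_self ht1'.ne'
  have hξt : ξ t = x := by rw [hξ₁ t le_rfl, hft, h₁1]
  have d₁ : ∀ s s' : unitInterval, s ≤ s' → s' ≤ t →
      dist (ξ s) (ξ s') = ((s' : ℝ) - s) * dist q r := by
    intro s s' hs hs'
    have : (s : ℝ) ≤ s' := hs
    rw [hξ₁ s (hs.trans hs'), hξ₁ s' hs', h₁, h₁0, h₁1, hf₁ s (hs.trans hs'), hf₁ s' hs', hq,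
      abs_sub_comm, ← sub_div, abs_of_nonneg (div_nonneg (by linarith) ht0.le)]
    field_simp
  have d₂ : ∀ s s' : unitInterval, s ≤ s' → t ≤ s →
      dist (ξ s) (ξ s') = ((s' : ℝ) - s) * dist q r := by
    intro s s' hs hs'
    have : (s : ℝ) ≤ s' := hs
    rw [hξ₂ s hs', hξ₂ s' (hs'.trans hs), h₂, h₂0, h₂1, hf₂ s hs', hf₂ s' (hs'.trans hs), hr,
      abs_sub_comm, ← sub_div, abs_of_nonneg (div_nonneg (by linarith) ht1'.le)]
    field_simp
    ring
  refine ⟨ξ, isGeodesic_of_dist_le fun s s' hs => ?_, hξ0, hξt, hξ1⟩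
  rw [hξ0, hξ1]
  rcases le_total s' t with h | h
  · exact (d₁ s s' hs h).le
  rcases le_total t s with h' | h'
  · exact (d₂ s s' hs h').le
  · refine (dist_triangle (ξ s) (ξ t) (ξ s')).trans ?_
    rw [d₁ s t h' le_rfl, d₂ t s' h le_rfl]
    linarith

lemma comparison_of_dist_eq (hY : IsNonnegCurvedAlexandrov Y) (p : Y) {q x r : Y}
    {t : unitInterval} (ht0 : 0 < (t : ℝ)) (ht1 : (t : ℝ) < 1) (hq : dist q x = t * dist q r)
    (hr : dist x r = (1 - t) * dist q r) :
    (1 - (t : ℝ)) * dist p q ^ 2 + t * dist p r ^ 2 ≤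
      dist p x ^ 2 + t * (1 - t) * dist q r ^ 2 := by
  obtain ⟨ξ, hξ, rfl, rfl, rfl⟩ := exists_geodesic_through hY.geodesic ht0 ht1 hq hr
  exact triangleComparison_iff.1 hY.comparison p ξ hξ t

end Comparison

/-! ### Completeness and curvature of the space of admissible measures -/

section Space

variable {X : Type*} [MetricSpace X] [MeasurableSpace X] [BorelSpace X] [ProperSpace X]
  {b : Prop} {A : Set X}

lemma planCost_le_of_vagueLim (hA : IsClosed A) (hne : A.Nonempty) (U : Ultrafilter ℕ)
    {μn νn : ℕ → Measure X} {μ ν : Measure X}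
    (hμn : ∀ n, IsAdmissible b A (μn n)) (hνn : ∀ n, IsAdmissible b A (νn n))
    (hμ : IsAdmissible b A μ) (hν : IsAdmissible b A ν) {M C : ℝ≥0}
    (hμM : ∀ n, moment A (μn n) ≤ M) (hνM : ∀ n, moment A (νn n) ≤ M)
    (hμl : VagueLim U Aᶜ μn μ) (hνl : VagueLim U Aᶜ νn ν)
    (hC : ∀ n, planCost b A (μn n) (νn n) ≤ C) {c : ℝ≥0∞}
    (hc : ∀ᶠ n in (U : Filter ℕ), planCost b A (μn n) (νn n) ≤ c) : planCost b A μ ν ≤ c := by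
  choose γn hγn _ hcost using fun n => exists_optimal_plan hA hne (hμn n) (hνn n)
  obtain ⟨γ, hγ, -, hγc⟩ := exists_plan_of_vagueLim hA hne U hγn
    (fun n => (hcost n).trans_le (hC n)) hμM hνM hμl hνl hμ.null hν.null
    (fun K hK hKc => measure_lt_top_of_moment hA hne hμ.moment_lt_top hK hKc)
    (fun K hK hKc => measure_lt_top_of_moment hA hne hν.moment_lt_top hK hKc)
  exact (planCost_le hγ).trans (hγc c (hc.mono fun n hn => (hcost n).trans_le hn))

/-- Integrate `d(y, A)² ≤ 2 d(x, A)² + 2 d(x, y)²` over an optimal plan. Thus sets bounded for the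
transport distance have bounded moments, hence are vaguely precompact. -/
lemma moment_le_add_planCost (hA : IsClosed A) (hne : A.Nonempty) {μ ν : Measure X}
    (hμ : IsAdmissible b A μ) (hν : IsAdmissible b A ν) :
    moment A ν ≤ 2 * moment A μ + 2 * planCost b A μ ν := by
  obtain ⟨γ, hγ, -, hc⟩ := exists_optimal_plan hA hne hμ hν
  nth_rewrite 1 [← hγ.snd, ← hγ.fst]
  rw [moment_restrict_compl, moment_restrict_compl, moment_map _ measurable_fst,
    moment_map _ measurable_snd, ← hc, cost, ← lintegral_const_mul _ (by fun_prop),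
    ← lintegral_const_mul _ measurable_nndist_sq, ← lintegral_add_left (by fun_prop)]
  refine lintegral_mono fun z => ?_
  have h1 : Metric.infNndist z.2 A ≤ Metric.infNndist z.1 A + nndist z.1 z.2 := by
    rw [nndist_comm]
    exact infNndist_le_add _ _
  have h2 : Metric.infNndist z.2 A ^ 2 ≤
      2 * Metric.infNndist z.1 A ^ 2 + 2 * nndist z.1 z.2 ^ 2 :=
    (pow_le_pow_left₀ zero_le h1 2).trans (by
      rw [← mul_add]
      exact add_sq_le)
  simpa only [ENNReal.coe_add, ENNReal.coe_mul, ENNReal.coe_ofNat] using ENNReal.coe_le_coe.2 h2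

section Alexandrov

variable {T : Type*} [MetricSpace T] {J : T → Measure X}

/-- The metric space `T` represents the admissible measures with the distance given by the optimal
cost. -/
structure Represents (b : Prop) (A : Set X) (J : T → Measure X) : Prop where
  admissible : ∀ t, IsAdmissible b A (J t)
  surj : ∀ μ, IsAdmissible b A μ → ∃ t, J t = μ
  planCost_eq : ∀ s t, planCost b A (J s) (J t) = ((nndist s t ^ 2 : ℝ≥0) : ℝ≥0∞)

/-- A Cauchy sequence has bounded moments and hence a vague ultralimit. By lower semicontinuity of
the cost, the Cauchy estimates pass to the distances from this limit. -/
lemma Represents.completeSpace (hT : Represents b A J) (hA : IsClosed A) (hne : A.Nonempty) :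
    CompleteSpace T := by
  refine Metric.complete_of_cauchySeq_tendsto fun u hu => ?_
  obtain ⟨R, hR, hbd⟩ := cauchySeq_bdd hu
  obtain ⟨m, hm⟩ := exists_nnreal_eq (hT.admissible (u 0)).moment_lt_top.ne
  have hcost : ∀ k n, planCost b A (J (u k)) (J (u n)) ≤ ((R.toNNReal ^ 2 : ℝ≥0) : ℝ≥0∞) := by
    intro k n
    rw [hT.planCost_eq, ENNReal.coe_le_coe]
    refine pow_le_pow_left₀ zero_le ?_ 2
    rw [← NNReal.coe_le_coe, Real.coe_toNNReal _ hR.le]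
    exact (hbd _ _).le
  have hM : ∀ n, moment A (J (u n)) ≤ ((2 * m + 2 * R.toNNReal ^ 2 : ℝ≥0) : ℝ≥0∞) := by
    intro n
    refine (moment_le_add_planCost hA hne (hT.admissible (u 0)) (hT.admissible (u n))).trans ?_
    push_cast
    rw [hm]
    gcongr
    exact_mod_cast hcost 0 n
  obtain ⟨μ, hμ, hlim, hμM⟩ := exists_admissible_vagueLim hA hne (hyperfilter ℕ)
    (fun n => hT.admissible (u n)) hM
  obtain ⟨t, rfl⟩ := hT.surj μ hμ
  refine ⟨t, Metric.tendsto_atTop.2 fun ε hε => ?_⟩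
  obtain ⟨N, hN⟩ := Metric.cauchySeq_iff.1 hu (ε / 2) (by linarith)
  refine ⟨N, fun n hn => ?_⟩
  have key : planCost b A (J (u n)) (J t) ≤ (((ε / 2).toNNReal ^ 2 : ℝ≥0) : ℝ≥0∞) := by
    refine planCost_le_of_vagueLim hA hne (hyperfilter ℕ) (μn := fun _ => J (u n))
      (νn := fun k => J (u k)) (fun _ => hT.admissible _) (fun _ => hT.admissible _)
      (hT.admissible _) (hT.admissible _) (fun _ => hM n) hM (fun f _ _ _ => tendsto_const_nhds)
      hlim (hcost n) ?_
    refine Nat.hyperfilter_le_atTop ?_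
    filter_upwards [eventually_ge_atTop N] with k hk
    rw [hT.planCost_eq, ENNReal.coe_le_coe]
    refine pow_le_pow_left₀ zero_le ?_ 2
    rw [← NNReal.coe_le_coe, Real.coe_toNNReal _ (by linarith)]
    exact (hN n hn k hk).le
  rw [hT.planCost_eq, ENNReal.coe_le_coe] at key
  have := (pow_le_pow_iff_left₀ zero_le zero_le two_ne_zero).1 key
  rw [← NNReal.coe_le_coe, Real.coe_toNNReal _ (by linarith)] at this
  have h2 : dist (u n) t ≤ ε / 2 := this
  linarith

lemma Represents.comparison (hT : Represents b A J) (hA : IsClosed A) (hne : A.Nonempty)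
    (hX : IsNonnegCurvedAlexandrov X) : TriangleComparison T := by
  refine triangleComparison_iff.2 fun p ξ hξ t => ?_
  rcases t.2.1.eq_or_lt with ht0 | ht0
  · have : t = 0 := Subtype.ext ht0.symm
    simp [this]
  rcases t.2.2.eq_or_lt with ht1 | ht1
  · have : t = 1 := Subtype.ext ht1
    simp [this]
  set q := ξ 0
  set r := ξ 1
  set x := ξ t
  let τ : ℝ≥0 := ⟨t, t.2.1⟩
  let σ : ℝ≥0 := ⟨1 - t, by linarith [t.2.2]⟩
  have hτ : (τ : ℝ) = t := rfl
  have hσ : (σ : ℝ) = 1 - t := rfl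
  have hτ0 : 0 < τ := ht0
  have hσ0 : 0 < σ := by
    rw [← NNReal.coe_pos]
    change 0 < 1 - (t : ℝ)
    linarith
  have hτσ : τ + σ = 1 := by
    apply NNReal.eq
    change (t : ℝ) + (1 - t) = 1
    ring
  have hxq : nndist x q = τ * nndist q r := by
    apply NNReal.eq
    push_cast
    rw [dist_comm, hξ 0 t, mul_comm]
    simp [hτ, abs_of_pos ht0, q, r]
  have hxr : nndist x r = σ * nndist q r := by
    apply NNReal.eq
    push_cast
    rw [hξ t 1, mul_comm, abs_sub_comm]
    simp [hσ, abs_of_pos (sub_pos.2 ht1), q, r]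
  -- Gluing at `x` keeps the distances from `x` exact, while the other pairs are coupled possibly
  -- non-optimally. That suffices: `d(p,q)` and `d(p,r)` need only upper bounds.
  obtain ⟨γp, hp, -, cp⟩ := exists_optimal_plan hA hne (hT.admissible x) (hT.admissible p)
  obtain ⟨γq, hq, -, cq⟩ := exists_optimal_plan hA hne (hT.admissible x) (hT.admissible q)
  obtain ⟨γr, hr, -, cr⟩ := exists_optimal_plan hA hne (hT.admissible x) (hT.admissible r)
  obtain ⟨Θ, hΘ, dp, dq, dr⟩ := exists_star hA hne (hT.admissible x) hp hq hr
  obtain ⟨mp, ep⟩ := dp.map_eq (by fun_prop) (by fun_prop) hp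
  obtain ⟨mq, eq⟩ := dq.map_eq (by fun_prop) (by fun_prop) hq
  obtain ⟨mr, er⟩ := dr.map_eq (by fun_prop) (by fun_prop) hr
  have kqr := planCost_le_lintegral hΘ (f := fun z => z.2.1.2) (g := fun z => z.2.2)
    (by fun_prop) (by fun_prop) mq mr
  have kpq := planCost_le_lintegral hΘ (f := fun z => z.2.1.1) (g := fun z => z.2.1.2)
    (by fun_prop) (by fun_prop) mp mq
  have kpr := planCost_le_lintegral hΘ (f := fun z => z.2.1.1) (g := fun z => z.2.2)
    (by fun_prop) (by fun_prop) mp mr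
  rw [cp, hT.planCost_eq] at ep
  rw [cq, hT.planCost_eq, hxq] at eq
  rw [cr, hT.planCost_eq, hxr] at er
  rw [hT.planCost_eq] at kqr kpq kpr
  -- By Cauchy-Schwarz with `τ + σ = 1`, `(a + c)² ≤ a² / τ + c² / σ`. Since `x` divides `[q r]` in
  -- ratio `τ : σ`, the right side integrates to exactly `d(q,r)²`, while `E` integrates to at least
  -- that. So `E = F` almost everywhere.
  let F : X × ((X × X) × X) → ℝ≥0 := fun z =>
    nndist z.1 z.2.1.2 ^ 2 / τ + nndist z.1 z.2.2 ^ 2 / σ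
  let E : X × ((X × X) × X) → ℝ≥0 := fun z => nndist z.2.1.2 z.2.2 ^ 2
  have hEF : ∀ z, E z ≤ F z := by
    intro z
    have h1 : E z ≤ (nndist z.1 z.2.1.2 + nndist z.1 z.2.2) ^ 2 :=
      pow_le_pow_left₀ zero_le (nndist_triangle_left _ _ _) 2
    refine h1.trans ?_
    rw [← NNReal.coe_le_coe]
    have h2 : (0 : ℝ) < τ := hτ0
    have h3 : (0 : ℝ) < σ := hσ0
    have h4 : (τ : ℝ) + σ = 1 := by exact_mod_cast hτσ
    simp only [F]
    push_cast
    generalize dist z.1 z.2.1.2 = a, dist z.1 z.2.2 = c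
    rw [div_add_div _ _ h2.ne' h3.ne', le_div_iff₀ (by positivity)]
    have h5 : (σ : ℝ) = 1 - τ := by linarith
    rw [h5]
    nlinarith [sq_nonneg ((1 - τ) * a - τ * c)]
  have hFint : ∫⁻ z, F z ∂Θ = ((nndist q r ^ 2 : ℝ≥0) : ℝ≥0∞) := by
    have e1 : ∀ z, (F z : ℝ≥0∞) = ((τ⁻¹ : ℝ≥0) : ℝ≥0∞) * (nndist z.1 z.2.1.2 ^ 2 : ℝ≥0) +
        ((σ⁻¹ : ℝ≥0) : ℝ≥0∞) * (nndist z.1 z.2.2 ^ 2 : ℝ≥0) := by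
      intro z
      rw [← ENNReal.coe_mul, ← ENNReal.coe_mul, ← ENNReal.coe_add]
      simp only [F]
      congr 1
      ring
    simp_rw [e1]
    rw [lintegral_add_left (by fun_prop), lintegral_const_mul _ (by fun_prop),
      lintegral_const_mul _ (by fun_prop), eq, er, ← ENNReal.coe_mul, ← ENNReal.coe_mul,
      ← ENNReal.coe_add]
    congr 1
    calc τ⁻¹ * (τ * nndist q r) ^ 2 + σ⁻¹ * (σ * nndist q r) ^ 2 =
        (τ + σ) * nndist q r ^ 2 := by
          field_simp
      _ = _ := by rw [hτσ, one_mul]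
  have hEint : ∫⁻ z, E z ∂Θ ≤ ((nndist q r ^ 2 : ℝ≥0) : ℝ≥0∞) :=
    (lintegral_mono fun z => ENNReal.coe_le_coe.2 (hEF z)).trans_eq hFint
  have hEqF : ∀ᵐ z ∂Θ, E z = F z := by
    have := ae_eq_of_ae_le_of_lintegral_le (μ := Θ) (f := fun z => (E z : ℝ≥0∞))
      (g := fun z => (F z : ℝ≥0∞)) (Eventually.of_forall fun z => ENNReal.coe_le_coe.2 (hEF z))
      (hEint.trans_lt ENNReal.coe_lt_top).ne (by fun_prop) (hFint.trans_le kqr)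
    filter_upwards [this] with z hz
    exact_mod_cast hz
  have hpt : ∀ᵐ z ∂Θ, σ * nndist z.2.1.1 z.2.1.2 ^ 2 + τ * nndist z.2.1.1 z.2.2 ^ 2 ≤
      nndist z.1 z.2.1.1 ^ 2 + τ * σ * E z := by
    filter_upwards [hEqF] with z hz
    have h2 : (0 : ℝ) < τ := hτ0
    have h3 : (0 : ℝ) < σ := hσ0
    have h5 : (σ : ℝ) = 1 - τ := rfl
    have hz' : dist z.2.1.2 z.2.2 ^ 2 * (τ * σ) =
        dist z.1 z.2.1.2 ^ 2 * σ + τ * dist z.1 z.2.2 ^ 2 := by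
      have := congrArg ((↑) : ℝ≥0 → ℝ) hz
      simp only [E, F] at this
      push_cast at this
      rwa [div_add_div _ _ h2.ne' h3.ne', eq_div_iff (by positivity)] at this
    have htri : dist z.2.1.2 z.2.2 ≤ dist z.1 z.2.1.2 + dist z.1 z.2.2 := dist_triangle_left _ _ _
    have h0 : (0 : ℝ) ≤ dist z.2.1.2 z.2.2 := dist_nonneg
    have ha0 : (0 : ℝ) ≤ dist z.1 z.2.1.2 := dist_nonneg
    have hc0 : (0 : ℝ) ≤ dist z.1 z.2.2 := dist_nonneg
    have hsq : dist z.2.1.2 z.2.2 ^ 2 ≤ (dist z.1 z.2.1.2 + dist z.1 z.2.2) ^ 2 :=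
      pow_le_pow_left₀ h0 htri 2
    -- Equality in Cauchy-Schwarz fixes the ratio of the two distances; equality in the triangle
    -- inequality (`hsum`) then places `z.1` on a geodesic at parameter `t`.
    have hac : (σ : ℝ) * dist z.1 z.2.1.2 = τ * dist z.1 z.2.2 := by
      have : ((σ : ℝ) * dist z.1 z.2.1.2 - τ * dist z.1 z.2.2) ^ 2 ≤ 0 := by
        have h6 := mul_le_mul_of_nonneg_right hsq (mul_pos h2 h3).le
        rw [hz', h5] at h6
        rw [h5]
        nlinarith
      have := pow_eq_zero_iff (two_ne_zero) |>.1 (le_antisymm this (sq_nonneg _))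
      linarith
    have hsum : dist z.2.1.2 z.2.2 = dist z.1 z.2.1.2 + dist z.1 z.2.2 := by
      refine le_antisymm htri (le_of_sq_le_sq ?_ h0)
      refine le_of_mul_le_mul_right ?_ (mul_pos h2 h3)
      rw [hz']
      rw [h5] at hac ⊢
      have hc : dist z.1 z.2.1.2 = τ * (dist z.1 z.2.1.2 + dist z.1 z.2.2) := by linarith
      nlinarith
    have hq' : dist z.2.1.2 z.1 = t * dist z.2.1.2 z.2.2 := by
      rw [dist_comm, hsum]
      rw [h5] at hac
      change _ = (τ : ℝ) * _
      linarith
    have hr' : dist z.1 z.2.2 = (1 - t) * dist z.2.1.2 z.2.2 := by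
      rw [hsum]
      rw [h5] at hac
      change _ = (1 - (τ : ℝ)) * _
      linarith
    have := comparison_of_dist_eq hX z.2.1.1 ht0 ht1 hq' hr'
    rw [← NNReal.coe_le_coe]
    simp only [E]
    push_cast
    rw [dist_comm z.1 z.2.1.1]
    exact this
  have hfinal : (σ : ℝ≥0∞) * (nndist p q ^ 2 : ℝ≥0) + τ * (nndist p r ^ 2 : ℝ≥0) ≤
      (nndist x p ^ 2 : ℝ≥0) + ((τ * σ : ℝ≥0) : ℝ≥0∞) * (nndist q r ^ 2 : ℝ≥0) := by
    calc (σ : ℝ≥0∞) * (nndist p q ^ 2 : ℝ≥0) + τ * (nndist p r ^ 2 : ℝ≥0)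
        ≤ σ * ∫⁻ z, (nndist z.2.1.1 z.2.1.2 ^ 2 : ℝ≥0) ∂Θ +
          τ * ∫⁻ z, (nndist z.2.1.1 z.2.2 ^ 2 : ℝ≥0) ∂Θ := by gcongr
      _ = ∫⁻ z, ((σ : ℝ≥0∞) * (nndist z.2.1.1 z.2.1.2 ^ 2 : ℝ≥0) +
          τ * (nndist z.2.1.1 z.2.2 ^ 2 : ℝ≥0)) ∂Θ := by
        rw [lintegral_add_left (by fun_prop), lintegral_const_mul _ (by fun_prop),
          lintegral_const_mul _ (by fun_prop)]
      _ ≤ ∫⁻ z, ((nndist z.1 z.2.1.1 ^ 2 : ℝ≥0) + ((τ * σ : ℝ≥0) : ℝ≥0∞) * E z) ∂Θ := by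
        refine lintegral_mono_ae (hpt.mono fun z hz => ?_)
        simpa only [ENNReal.coe_add, ENNReal.coe_mul] using ENNReal.coe_le_coe.2 hz
      _ = (nndist x p ^ 2 : ℝ≥0) + ((τ * σ : ℝ≥0) : ℝ≥0∞) * ∫⁻ z, E z ∂Θ := by
        rw [lintegral_add_left (by fun_prop), lintegral_const_mul _ (by fun_prop), ep]
      _ ≤ _ := by gcongr
  have hfin' : σ * nndist p q ^ 2 + τ * nndist p r ^ 2 ≤
      nndist x p ^ 2 + τ * σ * nndist q r ^ 2 := by
    exact_mod_cast hfinal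
  rw [← NNReal.coe_le_coe] at hfin'
  push_cast at hfin'
  rw [dist_comm x p] at hfin'
  exact hfin'

end Alexandrov

end Space

/-! ### Geodesics between admissible measures -/

section Geodesic

variable {X : Type*} [MetricSpace X] [MeasurableSpace X] [BorelSpace X] [ProperSpace X]
  {b : Prop} {A : Set X}

/-- The error is proportional to the distance from `A`, not constant, so that its square is
integrable even for plans of infinite mass. -/
lemma exists_measurable_approx (hA : IsClosed A) (hne : A.Nonempty) {ε : ℝ≥0} (hε : 0 < ε) :
    ∃ (d : ℕ → X × X) (N : X × X → ℕ), Measurable N ∧ ∀ z ∉ A ×ˢ A,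
      nndist z (d (N z)) ≤ ε * (Metric.infNndist z.1 A + Metric.infNndist z.2 A) := by
  have : Nonempty X := hne.to_type
  let d := TopologicalSpace.denseSeq (X × X)
  obtain ⟨N, hN, hNs⟩ := exists_measurable_nat
    (fun k => {z : X × X | nndist z (d k) ≤
      ε * (Metric.infNndist z.1 A + Metric.infNndist z.2 A)}) fun k =>
      measurableSet_le (by fun_prop) (by fun_prop)
  refine ⟨d, N, hN, fun z hz => hNs z ?_⟩
  have hpos : 0 < ε * (Metric.infNndist z.1 A + Metric.infNndist z.2 A) := by
    refine mul_pos hε ?_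
    by_cases h1 : z.1 ∈ A
    · exact lt_of_lt_of_le (infNndist_pos hA hne fun h2 => hz ⟨h1, h2⟩) le_add_self
    · exact lt_of_lt_of_le (infNndist_pos hA hne h1) le_self_add
  obtain ⟨k, hk⟩ := (TopologicalSpace.denseRange_denseSeq (X × X)).exists_dist_lt z
    (NNReal.coe_pos.2 hpos)
  exact ⟨k, NNReal.coe_le_coe.1 hk.le⟩

/-- Given a measure on `X × X`, there is an approximate measurable choice of geodesics joining the
points of `X` paired by this measure. -/
lemma exists_measurable_geodesic (hX : IsGeodesicSpace X) (hA : IsClosed A) (hne : A.Nonempty)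
    {γ : Measure (X × X)} (hγ0 : γ (A ×ˢ A) = 0) {D R : ℝ≥0} (hD : cost γ ≤ D)
    (hR : ∫⁻ z, ((Metric.infNndist z.1 A + Metric.infNndist z.2 A) ^ 2 : ℝ≥0) ∂γ ≤ R)
    {ε : ℝ≥0} (hε : 0 < ε) (hε1 : ε ≤ 1) :
    ∃ G : unitInterval → X × X → X, (∀ t, Measurable (G t)) ∧
      (∀ t, ∫⁻ z, (Metric.infNndist (G t z) A ^ 2 : ℝ≥0) ∂γ ≤ ((4 * D + 24 * R : ℝ≥0) : ℝ≥0∞)) ∧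
      (∀ s t, ∫⁻ z, (nndist (G s z) (G t z) ^ 2 : ℝ≥0) ∂γ ≤
        ((nndist s t ^ 2 * ((1 + ε) * D + 8 * ε * R) : ℝ≥0) : ℝ≥0∞)) ∧
      ∫⁻ z, (nndist z.1 (G 0 z) ^ 2 : ℝ≥0) ∂γ ≤ ((ε * R : ℝ≥0) : ℝ≥0∞) ∧
      ∫⁻ z, (nndist z.2 (G 1 z) ^ 2 : ℝ≥0) ∂γ ≤ ((ε * R : ℝ≥0) : ℝ≥0∞) := by
  obtain ⟨d, N, hN, hd⟩ := exists_measurable_approx hA hne hε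
  -- An arbitrary choice of geodesics is harmless: only the countably many pairs `d k` are used, and
  -- `N` is measurable.
  choose ξ hξ hξ0 hξ1 using hX
  set ρ : X × X → ℝ≥0 := fun z => Metric.infNndist z.1 A + Metric.infNndist z.2 A with hρ
  have hρm : Measurable ρ := by fun_prop
  have hbound : ∀ (f : X × X → ℝ≥0) (α β : ℝ≥0),
      (∀ z ∉ A ×ˢ A, f z ≤ α * nndist z.1 z.2 ^ 2 + β * ρ z ^ 2) →
      ∫⁻ z, f z ∂γ ≤ ((α * D + β * R : ℝ≥0) : ℝ≥0∞) := by
    intro f α β h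
    calc ∫⁻ z, f z ∂γ
        ≤ ∫⁻ z, ((α : ℝ≥0∞) * (nndist z.1 z.2 ^ 2 : ℝ≥0) + β * (ρ z ^ 2 : ℝ≥0)) ∂γ := by
          refine lintegral_mono_ae ?_
          filter_upwards [measure_eq_zero_iff_ae_notMem.1 hγ0] with z hz
          simpa only [ENNReal.coe_add, ENNReal.coe_mul] using ENNReal.coe_le_coe.2 (h z hz)
      _ = α * cost γ + β * ∫⁻ z, (ρ z ^ 2 : ℝ≥0) ∂γ := by
          rw [lintegral_add_left (by fun_prop), lintegral_const_mul _ measurable_nndist_sq,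
            lintegral_const_mul _ (by fun_prop)]
          rfl
      _ ≤ α * D + β * R := by gcongr
      _ = _ := by push_cast; rfl
  have hclose : ∀ z ∉ A ×ˢ A, nndist z.1 (d (N z)).1 ≤ ε * ρ z ∧ nndist z.2 (d (N z)).2 ≤ ε * ρ z :=
    fun z hz => ⟨(le_max_left (nndist z.1 (d (N z)).1) (nndist z.2 (d (N z)).2)).trans (hd z hz),
      (le_max_right (nndist z.1 (d (N z)).1) (nndist z.2 (d (N z)).2)).trans (hd z hz)⟩
  have hlen : ∀ z ∉ A ×ˢ A, nndist (d (N z)).1 (d (N z)).2 ≤ nndist z.1 z.2 + 2 * ε * ρ z := by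
    intro z hz
    obtain ⟨h1, h2⟩ := hclose z hz
    rw [nndist_comm] at h1
    calc nndist (d (N z)).1 (d (N z)).2 ≤
          nndist (d (N z)).1 z.1 + nndist z.1 z.2 + nndist z.2 (d (N z)).2 := by
          have := dist_triangle4 (d (N z)).1 z.1 z.2 (d (N z)).2
          exact_mod_cast this
      _ ≤ ε * ρ z + nndist z.1 z.2 + ε * ρ z := by gcongr
      _ = _ := by ring
  have hgeo : ∀ (x y : X) (s t : unitInterval),
      nndist (ξ x y s) (ξ x y t) = nndist x y * nndist s t := by
    intro x y s t
    apply NNReal.eq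
    push_cast
    rw [hξ x y s t, hξ0, hξ1]
    rfl
  refine ⟨fun t z => ξ (d (N z)).1 (d (N z)).2 t, fun t => ?_, fun t => ?_, fun s t => ?_, ?_, ?_⟩
  · exact (measurable_from_nat (f := fun k => ξ (d k).1 (d k).2 t)).comp hN
  · refine hbound _ _ _ fun z hz => ?_
    have h1 : Metric.infNndist (ξ (d (N z)).1 (d (N z)).2 t) A ≤
        4 * ρ z + nndist z.1 z.2 := by
      calc Metric.infNndist (ξ (d (N z)).1 (d (N z)).2 t) A
          ≤ Metric.infNndist z.1 A + nndist (ξ (d (N z)).1 (d (N z)).2 t) z.1 :=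
            infNndist_le_add _ _
        _ ≤ Metric.infNndist z.1 A + (nndist (ξ (d (N z)).1 (d (N z)).2 t) (d (N z)).1 +
            nndist (d (N z)).1 z.1) := by
            gcongr
            exact nndist_triangle _ _ _
        _ ≤ ρ z + ((nndist z.1 z.2 + 2 * ε * ρ z) + ε * ρ z) := by
            gcongr
            · exact le_self_add
            · have hd0 := hgeo (d (N z)).1 (d (N z)).2 t 0
              rw [hξ0] at hd0
              rw [hd0]
              refine (mul_le_of_le_one_right zero_le ?_).trans (hlen z hz)
              rw [← NNReal.coe_le_coe]
              change |(t : ℝ) - 0| ≤ 1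
              rw [sub_zero, abs_of_nonneg t.2.1]
              exact t.2.2
            · rw [nndist_comm]
              exact (hclose z hz).1
        _ ≤ ρ z + ((nndist z.1 z.2 + 2 * 1 * ρ z) + 1 * ρ z) := by gcongr
        _ = _ := by ring
    refine (pow_le_pow_left₀ zero_le h1 2).trans ?_
    rw [← NNReal.coe_le_coe]
    push_cast
    -- The constants `4` and `24` come from `(4 ρ + d)² ≤ 4 d² + 24 ρ²`.
    nlinarith [sq_nonneg ((ρ z : ℝ) * 2 - 3 * dist z.1 z.2)]
  · refine (hbound _ (nndist s t ^ 2 * (1 + ε)) (nndist s t ^ 2 * (8 * ε)) fun z hz => ?_).trans_eq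
      (by congr 1; ring)
    rw [hgeo, mul_pow, mul_comm, mul_assoc, mul_assoc, ← mul_add]
    gcongr
    refine (pow_le_pow_left₀ zero_le (hlen z hz) 2).trans ?_
    rw [← NNReal.coe_le_coe]
    push_cast
    have h0 : (0 : ℝ) ≤ ε := ε.2
    have h1 : (ε : ℝ) ≤ 1 := hε1
    generalize dist z.1 z.2 = a
    generalize (ρ z : ℝ) = c
    -- This is `(a + 2 ε c)² ≤ (1 + ε) a² + 8 ε c²`, from `4 a c ≤ a² + 4 c²` and `ε² ≤ ε`.
    nlinarith [mul_nonneg h0 (sq_nonneg (a - 2 * c)), mul_nonneg (mul_nonneg h0 (sub_nonneg.2 h1))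
      (sq_nonneg c)]
  · refine (hbound _ 0 ε fun z hz => ?_).trans_eq (by rw [zero_mul, zero_add])
    simp only [hξ0, zero_mul, zero_add]
    calc nndist z.1 (d (N z)).1 ^ 2 ≤ (ε * ρ z) ^ 2 :=
          pow_le_pow_left₀ zero_le (hclose z hz).1 2
      _ = ε * (ε * ρ z ^ 2) := by ring
      _ ≤ ε * (1 * ρ z ^ 2) := by gcongr
      _ = _ := by rw [one_mul]
  · refine (hbound _ 0 ε fun z hz => ?_).trans_eq (by rw [zero_mul, zero_add])
    simp only [hξ1, zero_mul, zero_add]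
    calc nndist z.2 (d (N z)).2 ^ 2 ≤ (ε * ρ z) ^ 2 :=
          pow_le_pow_left₀ zero_le (hclose z hz).2 2
      _ = ε * (ε * ρ z ^ 2) := by ring
      _ ≤ ε * (1 * ρ z ^ 2) := by gcongr
      _ = _ := by rw [one_mul]

variable {T : Type*} [MetricSpace T] {J : T → Measure X}

lemma Represents.isGeodesicSpace (hT : Represents b A J) (hA : IsClosed A) (hne : A.Nonempty)
    (hX : IsGeodesicSpace X) : IsGeodesicSpace T := by
  intro x y
  obtain ⟨γ, hγ, hγ0, hc⟩ := exists_optimal_plan hA hne (hT.admissible x) (hT.admissible y)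
  rw [hT.planCost_eq] at hc
  set D := nndist x y ^ 2 with hD
  obtain ⟨m₁, hm₁⟩ := exists_nnreal_eq (hT.admissible x).moment_lt_top.ne
  obtain ⟨m₂, hm₂⟩ := exists_nnreal_eq (hT.admissible y).moment_lt_top.ne
  set R : ℝ≥0 := 2 * m₁ + 2 * m₂ with hRdef
  have hR : ∫⁻ z, ((Metric.infNndist z.1 A + Metric.infNndist z.2 A) ^ 2 : ℝ≥0) ∂γ ≤ R := by
    have e1 : moment A (J x) = ∫⁻ z, (Metric.infNndist z.1 A ^ 2 : ℝ≥0) ∂γ := by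
      rw [← hγ.fst, moment_restrict_compl, moment_map _ measurable_fst]
    have e2 : moment A (J y) = ∫⁻ z, (Metric.infNndist z.2 A ^ 2 : ℝ≥0) ∂γ := by
      rw [← hγ.snd, moment_restrict_compl, moment_map _ measurable_snd]
    rw [hRdef, ENNReal.coe_add, ENNReal.coe_mul, ENNReal.coe_mul, ENNReal.coe_ofNat, hm₁, hm₂,
      e1, e2, ← lintegral_const_mul _ (by fun_prop),
      ← lintegral_const_mul _ (by fun_prop), ← lintegral_add_left (by fun_prop)]
    refine lintegral_mono fun z => ?_
    have := ENNReal.coe_le_coe.2 (add_sq_le (a := Metric.infNndist z.1 A)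
      (b := Metric.infNndist z.2 A))
    rw [mul_add] at this
    simpa only [ENNReal.coe_add, ENNReal.coe_mul, ENNReal.coe_ofNat] using this
  let ε : ℕ → ℝ≥0 := fun n => 1 / ((n : ℝ≥0) + 1)
  have hε0 : ∀ n, 0 < ε n := fun n => by positivity
  have hε1 : ∀ n, ε n ≤ 1 := fun n => by
    simp only [ε]
    rw [div_le_one (by positivity)]
    exact le_add_self
  have hεlim : Tendsto ε (hyperfilter ℕ) (𝓝 0) :=
    tendsto_one_div_add_atTop_nhds_zero_nat.mono_left Nat.hyperfilter_le_atTop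
  choose G hGm hGA hGd hG0 hG1 using fun n => exists_measurable_geodesic hX hA hne hγ0 hc.le hR
    (hε0 n) (hε1 n)
  let μ : ℕ → unitInterval → Measure X := fun n t => (γ.map (G n t)).restrict Aᶜ
  have hμM : ∀ t n, moment A (μ n t) ≤ ((4 * D + 24 * R : ℝ≥0) : ℝ≥0∞) := by
    intro t n
    simp only [μ]
    rw [moment_restrict_compl, moment_map _ (hGm n t)]
    exact hGA n t
  have hμ : ∀ n t, IsAdmissible b A (μ n t) := by
    intro n t
    refine ⟨?_, (hμM t n).trans_lt ENNReal.coe_lt_top, fun hb =>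
      ((hγ.point hb).map (hGm n t)).restrict hA.measurableSet.compl⟩
    simp only [μ]
    rw [Measure.restrict_apply hA.measurableSet]
    simp
  -- One ultrafilter serves all times `t` at once, so no diagonal extraction over a dense set of
  -- times is needed.
  have hlim : ∀ t, ∃ ζ : T, VagueLim (hyperfilter ℕ) Aᶜ (fun n => μ n t) (J ζ) := by
    intro t
    obtain ⟨μt, h1, h2, -⟩ := exists_admissible_vagueLim hA hne (hyperfilter ℕ)
      (fun n => hμ n t) (hμM t)
    obtain ⟨ζ, rfl⟩ := hT.surj μt h1
    exact ⟨ζ, h2⟩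
  choose ζ hζ using hlim
  -- The approximate curves miss the endpoints by a cost of at most `ε n * R`, which tends to `0`;
  -- so the limit curve has the exact endpoints.
  have hends : ∀ (w : T) (t : unitInterval) (f : X × X → X), Measurable f →
      (γ.map f).restrict Aᶜ = J w →
      (∀ n, ∫⁻ z, (nndist (f z) (G n t z) ^ 2 : ℝ≥0) ∂γ ≤ ((ε n * R : ℝ≥0) : ℝ≥0∞)) →
      ζ t = w := by
    intro w t f hf hfw hfG
    have hcost : ∀ n, planCost b A (J w) (μ n t) ≤ ((ε n * R : ℝ≥0) : ℝ≥0∞) := fun n =>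
      (planCost_le_lintegral hγ.point hf (hGm n t) hfw rfl).trans (hfG n)
    obtain ⟨m, hm⟩ := exists_nnreal_eq (hT.admissible w).moment_lt_top.ne
    have hz : planCost b A (J w) (J (ζ t)) ≤ 0 := by
      refine le_of_forall_gt_imp_ge_of_dense fun c hc => ?_
      refine planCost_le_of_vagueLim hA hne (hyperfilter ℕ) (fun _ => hT.admissible w)
        (fun n => hμ n t) (hT.admissible w) (hT.admissible _) (M := 4 * D + 24 * R + m) (C := R)
        (fun _ => ?_) (fun n => (hμM t n).trans ?_) (fun _ _ _ _ => tendsto_const_nhds) (hζ t)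
        (fun n => (hcost n).trans ?_) ?_
      · rw [← hm]
        exact ENNReal.coe_le_coe.2 le_add_self
      · exact ENNReal.coe_le_coe.2 le_self_add
      · exact ENNReal.coe_le_coe.2 (mul_le_of_le_one_left zero_le (hε1 n))
      · have hl : Tendsto (fun n => ((ε n * R : ℝ≥0) : ℝ≥0∞)) (hyperfilter ℕ)
            (𝓝 ((0 * R : ℝ≥0) : ℝ≥0∞)) := ENNReal.tendsto_coe.2 (hεlim.mul_const R)
        rw [zero_mul, ENNReal.coe_zero] at hl
        exact (hl.eventually_lt_const hc).mono fun n hn => (hcost n).trans hn.le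
    rw [hT.planCost_eq] at hz
    have h0 : nndist w (ζ t) ^ 2 = 0 := by exact_mod_cast le_antisymm hz zero_le
    exact (nndist_eq_zero.1 (pow_eq_zero_iff two_ne_zero |>.1 h0)).symm
  have hζ0 : ζ 0 = x := hends x 0 Prod.fst measurable_fst hγ.fst hG0
  have hζ1 : ζ 1 = y := hends y 1 Prod.snd measurable_snd hγ.snd hG1
  refine ⟨ζ, isGeodesic_of_dist_le fun s t hst => ?_, hζ0, hζ1⟩
  have hcost : ∀ n, planCost b A (μ n s) (μ n t) ≤
      ((nndist s t ^ 2 * ((1 + ε n) * D + 8 * ε n * R) : ℝ≥0) : ℝ≥0∞) := fun n =>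
    (planCost_le_lintegral hγ.point (hGm n s) (hGm n t) rfl rfl).trans (hGd n s t)
  have hz : planCost b A (J (ζ s)) (J (ζ t)) ≤ ((nndist s t ^ 2 * D : ℝ≥0) : ℝ≥0∞) := by
    refine le_of_forall_gt_imp_ge_of_dense fun c hc => ?_
    refine planCost_le_of_vagueLim hA hne (hyperfilter ℕ) (fun n => hμ n s)
      (fun n => hμ n t) (hT.admissible _) (hT.admissible _)
      (C := nndist s t ^ 2 * ((1 + 1) * D + 8 * 1 * R))
      (hμM s) (hμM t) (hζ s) (hζ t) (fun n => (hcost n).trans ?_) ?_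
    · refine ENNReal.coe_le_coe.2 ?_
      gcongr
      · exact hε1 n
      · exact hε1 n
    · have hl : Tendsto (fun n => ((nndist s t ^ 2 * ((1 + ε n) * D + 8 * ε n * R) : ℝ≥0) : ℝ≥0∞))
          (hyperfilter ℕ) (𝓝 ((nndist s t ^ 2 * ((1 + 0) * D + 8 * 0 * R) : ℝ≥0) : ℝ≥0∞)) :=
        ENNReal.tendsto_coe.2 ((((hεlim.const_add 1).mul_const D).add
          ((hεlim.const_mul 8).mul_const R)).const_mul _)
      rw [add_zero, one_mul, mul_zero, zero_mul, add_zero] at hl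
      exact (hl.eventually_lt_const hc).mono fun n hn => (hcost n).trans hn.le
  rw [hT.planCost_eq, ENNReal.coe_le_coe, hD, ← mul_pow] at hz
  have hz' := (pow_le_pow_iff_left₀ zero_le zero_le two_ne_zero).1 hz
  rw [← NNReal.coe_le_coe] at hz'
  push_cast at hz'
  rw [hζ0, hζ1]
  have : dist s t = (t : ℝ) - s := by
    rw [dist_comm]
    change |(t : ℝ) - s| = _
    exact abs_of_nonneg (sub_nonneg.2 hst)
  rwa [this] at hz'

end Geodesic

/-! ### The Alexandrov space attached to the optimal cost -/

section Main

variable {X : Type*} [MetricSpace X] [MeasurableSpace X] [BorelSpace X] [ProperSpace X]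

/-- Any parametrization of the admissible measures is a non-negatively curved Alexandrov space for
the distance given by the optimal cost. -/
theorem exists_alexandrov_of_planCost (b : Prop) {A : Set X} (hA : IsClosed A) (hne : A.Nonempty)
    (hX : IsNonnegCurvedAlexandrov X) {T : Type*} (J : T → Measure X)
    (hinj : Function.Injective J) (hadm : ∀ t, IsAdmissible b A (J t))
    (hsurj : ∀ μ, IsAdmissible b A μ → ∃ t, J t = μ) (W : T → T → ℝ≥0∞)
    (hW : ∀ s t, W s t = planCost b A (J s) (J t) ^ (1 / 2 : ℝ)) :
    ∃ _ : MetricSpace T, (∀ s t : T, edist s t = W s t) ∧ IsNonnegCurvedAlexandrov T := by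
  let E : EMetricSpace T :=
    { edist := fun s t => planCost b A (J s) (J t) ^ (1 / 2 : ℝ)
      edist_self := fun t => by
        rw [planCost_self (hadm t)]
        simp
      edist_comm := fun s t => by rw [planCost_comm]
      edist_triangle := fun s t u => planCost_rpow_triangle hA hne (hadm s) (hadm t) (hadm u)
      eq_of_edist_eq_zero := fun {s t} h => by
        refine hinj (eq_of_planCost_eq_zero hA hne (hadm s) (hadm t) ?_)
        have h' : planCost b A (J s) (J t) ^ (1 / 2 : ℝ) = 0 := h
        rw [ENNReal.rpow_eq_zero_iff] at h'
        rcases h' with h' | h'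
        · exact h'.1
        · norm_num at h' }
  let M : MetricSpace T := EMetricSpace.toMetricSpace fun s t =>
    (ENNReal.rpow_lt_top_of_nonneg (by norm_num)
      (planCost_lt_top hA hne (hadm s) (hadm t)).ne).ne
  have hed : ∀ s t : T, edist s t = planCost b A (J s) (J t) ^ (1 / 2 : ℝ) := fun s t => rfl
  have hT : Represents b A J := by
    refine ⟨hadm, hsurj, fun s t => ?_⟩
    rw [ENNReal.coe_pow, ← edist_nndist, hed, ← ENNReal.rpow_two, ← ENNReal.rpow_mul]
    norm_num
  refine ⟨M, fun s t => (hed s t).trans (hW s t).symm, ?_⟩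
  exact ⟨hT.completeSpace hA hne, hT.isGeodesicSpace hA hne hX.geodesic,
    hT.comparison hA hne hX⟩

end Main

/-! ### Radon measures on `Ω` and diagrams as admissible measures -/

section Representations

variable {X : Type*} [MetricSpace X] {A : Set X}

lemma infEDist_rpow_two (hne : A.Nonempty) (x : X) :
    Metric.infEDist x A ^ (2 : ℝ) = ((Metric.infNndist x A ^ 2 : ℝ≥0) : ℝ≥0∞) := by
  rw [ENNReal.rpow_two, ENNReal.coe_pow]
  congr 1
  exact (ENNReal.coe_toNNReal (Metric.infEDist_ne_top hne)).symm

lemma edist_rpow_two (x y : X) : edist x y ^ (2 : ℝ) = ((nndist x y ^ 2 : ℝ≥0) : ℝ≥0∞) := by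
  rw [ENNReal.rpow_two, ENNReal.coe_pow, edist_nndist]

variable [MeasurableSpace X] [BorelSpace X] [ProperSpace X]

section Measures

lemma map_val_injective (hA : IsClosed A) :
    Function.Injective fun μ : Measure (Aᶜ : Set X) => μ.map Subtype.val := by
  have hme := MeasurableEmbedding.subtype_coe hA.measurableSet.compl
  intro μ ν h
  rw [← hme.comap_map μ, ← hme.comap_map ν]
  exact congrArg _ h

lemma comap_val_eq_iff (hA : IsClosed A) (m : Measure X) (μ : Measure (Aᶜ : Set X)) :
    m.comap Subtype.val = μ ↔ m.restrict Aᶜ = μ.map Subtype.val := by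
  have hme := MeasurableEmbedding.subtype_coe hA.measurableSet.compl
  rw [← (map_val_injective hA).eq_iff]
  rw [hme.map_comap, Subtype.range_coe]

lemma isAdmissible_map_val_iff (hA : IsClosed A) (hne : A.Nonempty) (μ : Measure (Aᶜ : Set X)) :
    IsAdmissible False A (μ.map Subtype.val) ↔ IsFiniteMeasureOnCompacts μ ∧ μ.InnerRegular ∧
      ∫⁻ x, Metric.infEDist (x : X) A ^ (2 : ℝ) ∂μ < ∞ := by
  have hme := MeasurableEmbedding.subtype_coe hA.measurableSet.compl
  have e : moment A (μ.map Subtype.val) = ∫⁻ x, Metric.infEDist (x : X) A ^ (2 : ℝ) ∂μ := by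
    rw [moment_map _ measurable_subtype_coe]
    simp_rw [infEDist_rpow_two hne]
  constructor
  · intro h
    have h1 : IsFiniteMeasureOnCompacts μ := by
      refine ⟨fun K hK => ?_⟩
      have := measure_lt_top_of_moment hA hne h.moment_lt_top (K := Subtype.val '' K) (by simp)
        (hK.image continuous_subtype_val)
      rwa [hme.map_apply, preimage_image_eq _ Subtype.val_injective] at this
    -- Inner regularity is then automatic for a measure finite on compact sets.
    have : LocallyCompactSpace (Aᶜ : Set X) := hA.isOpen_compl.locallyCompactSpace
    exact ⟨h1, inferInstance, e ▸ h.moment_lt_top⟩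
  · rintro ⟨-, -, h⟩
    refine ⟨?_, e.trans_lt h, False.elim⟩
    rw [hme.map_apply]
    convert! measure_empty (μ := μ)
    ext x
    simp

/-- Plans on `X × X` may charge `A × A`, but an optimal one can be taken without mass there and so
comes from a measure on `E_Ω`. -/
lemma Wb_eq (hA : IsClosed A) (hne : A.Nonempty) (μ ν : RadonMeasures 2 A) :
    Wb 2 μ ν = planCost False A (μ.1.map Subtype.val) (ν.1.map Subtype.val) ^ (1 / 2 : ℝ) := by
  have hE : MeasurableSet ((A ×ˢ A)ᶜ : Set (X × X)) := (hA.prod hA).measurableSet.compl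
  have hme := MeasurableEmbedding.subtype_coe hE
  have hμ := (isAdmissible_map_val_iff hA hne μ.1).2 μ.2
  have hν := (isAdmissible_map_val_iff hA hne ν.1).2 ν.2
  have hcost : ∀ γ : Measure ((A ×ˢ A)ᶜ : Set (X × X)),
      ∫⁻ z, edist (z : X × X).1 (z : X × X).2 ^ (2 : ℝ) ∂γ = cost (γ.map Subtype.val) := by
    intro γ
    rw [cost_map _ measurable_subtype_coe]
    simp_rw [edist_rpow_two]
  have hadm : ∀ γ : Measure ((A ×ˢ A)ᶜ : Set (X × X)), γ ∈ Adm μ.1 ν.1 ↔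
      IsPlan False A (μ.1.map Subtype.val) (ν.1.map Subtype.val) (γ.map Subtype.val) := by
    intro γ
    have e1 : γ.map (fun z : ((A ×ˢ A)ᶜ : Set (X × X)) => (z : X × X).1) =
        (γ.map Subtype.val).map Prod.fst :=
      (Measure.map_map measurable_fst measurable_subtype_coe).symm
    have e2 : γ.map (fun z : ((A ×ˢ A)ᶜ : Set (X × X)) => (z : X × X).2) =
        (γ.map Subtype.val).map Prod.snd :=
      (Measure.map_map measurable_snd measurable_subtype_coe).symm
    rw [Adm, Set.mem_ofPred_eq, e1, e2, comap_val_eq_iff hA, comap_val_eq_iff hA]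
    exact ⟨fun h => ⟨h.1, h.2, False.elim⟩, fun h => ⟨h.fst, h.snd⟩⟩
  refine le_antisymm ?_ ?_
  · obtain ⟨γ, hγ, hγ0, hc⟩ := exists_optimal_plan hA hne hμ hν
    have e : (γ.comap Subtype.val : Measure ((A ×ˢ A)ᶜ : Set (X × X))).map Subtype.val = γ := by
      rw [hme.map_comap, Subtype.range_coe]
      exact restrict_compl_eq_self hγ0
    refine (iInf₂_le (γ.comap Subtype.val) ((hadm _).2 (e.symm ▸ hγ))).trans_eq ?_
    rw [hcost, e, hc]
  · refine le_iInf₂ fun γ hγ => ENNReal.rpow_le_rpow ?_ (by norm_num)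
    rw [hcost]
    exact planCost_le ((hadm γ).1 hγ)

end Measures

section Diagrams

lemma IsPointMeasure.ext {Z : Type*} [MeasurableSpace Z] [MeasurableSingletonClass Z]
    {γ γ' : Measure Z} (h : IsPointMeasure γ) (h' : IsPointMeasure γ')
    (hs : ∀ z, γ {z} = γ' {z}) : γ = γ' := by
  obtain ⟨s, u, hu⟩ := h
  obtain ⟨s', u', hu'⟩ := h'
  set S : Set Z := range u ∪ range u' with hS
  have hSc : S.Countable := (countable_range u).union (countable_range u')
  have h1 : γ Sᶜ = 0 := by
    rw [hu, sum_dirac_apply _ hSc.measurableSet.compl]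
    have : u ⁻¹' Sᶜ = ∅ := by
      ext i
      simp [hS]
    simp [this]
  have h2 : γ' Sᶜ = 0 := by
    rw [hu', sum_dirac_apply _ hSc.measurableSet.compl]
    have : u' ⁻¹' Sᶜ = ∅ := by
      ext i
      simp [hS]
    simp [this]
  ext B hB
  have key : ∀ m : Measure Z, m Sᶜ = 0 → m B = ∑' z : (B ∩ S : Set Z), m {(z : Z)} := by
    intro m hm
    rw [← measure_inter_conull hm, ← measure_biUnion (hSc.mono inter_subset_right)]
    · rw [biUnion_of_singleton]
    · intro z _ w _ hzw
      simpa [Function.onFun] using hzw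
    · exact fun z _ => measurableSet_singleton z
  rw [key γ h1, key γ' h2]
  simp_rw [hs]

/-- The measure on `X` with multiplicities `σ` at the points of the complement of `A`. -/
noncomputable def diagramMeasure (σ : (Aᶜ : Set X) → ℕ) : Measure X :=
  Measure.sum fun i : (Σ x : (Aᶜ : Set X), Fin (σ x)) => Measure.dirac (i.1 : X)

lemma diagramMeasure_apply (σ : (Aᶜ : Set X) → ℕ) {B : Set X} (hB : MeasurableSet B) :
    diagramMeasure σ B = ∑' x : (Aᶜ : Set X), (σ x : ℝ≥0∞) * B.indicator 1 (x : X) := by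
  rw [diagramMeasure, Measure.sum_apply _ hB,
    ENNReal.tsum_sigma fun (x : (Aᶜ : Set X)) (_ : Fin (σ x)) => Measure.dirac (x : X) B]
  congr 1 with x
  simp [Measure.dirac_apply' _ hB]

lemma diagramMeasure_singleton (σ : (Aᶜ : Set X) → ℕ) (x : (Aᶜ : Set X)) :
    diagramMeasure σ {(x : X)} = σ x := by
  rw [diagramMeasure_apply σ (measurableSet_singleton _), tsum_eq_single x]
  · simp
  · intro y hy
    have : (y : X) ≠ x := fun h => hy (Subtype.ext h)
    simp [this]

lemma diagramMeasure_null (hA : IsClosed A) (σ : (Aᶜ : Set X) → ℕ) : diagramMeasure σ A = 0 := by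
  rw [diagramMeasure_apply σ hA.measurableSet, ENNReal.tsum_eq_zero]
  intro x
  have : (x : X) ∉ A := x.2
  simp [this]

lemma moment_diagramMeasure (hne : A.Nonempty) (σ : (Aᶜ : Set X) → ℕ) :
    moment A (diagramMeasure σ) =
      ∑' x : (Aᶜ : Set X), (σ x : ℝ≥0∞) * Metric.infEDist (x : X) A ^ (2 : ℝ) := by
  rw [moment, diagramMeasure, lintegral_sum_measure]
  simp_rw [lintegral_dirac' _ measurable_infNndist_sq]
  rw [ENNReal.tsum_sigma fun (x : (Aᶜ : Set X)) (_ : Fin (σ x)) =>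
    ((Metric.infNndist (x : X) A ^ 2 : ℝ≥0) : ℝ≥0∞)]
  congr 1 with x
  simp [infEDist_rpow_two hne]

lemma isPointMeasure_diagramMeasure {σ : (Aᶜ : Set X) → ℕ} (hσ : {x | σ x ≠ 0}.Countable) :
    IsPointMeasure (diagramMeasure σ) := by
  have : Countable {x | σ x ≠ 0} := hσ.to_subtype
  have : Countable (Σ x : (Aᶜ : Set X), Fin (σ x)) := by
    let f : (Σ x : (Aᶜ : Set X), Fin (σ x)) → {x | σ x ≠ 0} × ℕ :=
      fun i => (⟨i.1, (Fin.pos i.2).ne'⟩, i.2)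
    refine Function.Injective.countable (f := f) ?_
    rintro ⟨x, i⟩ ⟨y, j⟩ h
    simp only [f, Prod.mk.injEq, Subtype.mk.injEq] at h
    obtain ⟨rfl, h⟩ := h
    rw [Fin.ext h]
  exact isPointMeasure_sum_dirac _

lemma isAdmissible_diagramMeasure (hA : IsClosed A) (hne : A.Nonempty)
    (σ : PersistenceDiagrams 2 A) : IsAdmissible True A (diagramMeasure σ.1) := by
  refine ⟨diagramMeasure_null hA _, (moment_diagramMeasure hne _).trans_lt σ.2, fun _ => ?_⟩
  refine isPointMeasure_diagramMeasure ?_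
  -- Each point of `Ω` has positive distance to `A`, so finiteness of the sum makes the support of
  -- `σ` countable.
  have := Summable.countable_support_ennreal σ.2.ne
  refine this.mono fun x hx => ?_
  have h1 : Metric.infEDist (x : X) A ^ (2 : ℝ) ≠ 0 := by
    rw [infEDist_rpow_two hne]
    exact_mod_cast (pow_pos (infNndist_pos hA hne x.2) 2).ne'
  simpa using ⟨hx, by simpa using h1⟩

lemma exists_diagramMeasure_eq (hA : IsClosed A) (hne : A.Nonempty) {μ : Measure X}
    (hμ : IsAdmissible True A μ) : ∃ σ : PersistenceDiagrams 2 A, diagramMeasure σ.1 = μ := by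
  have hpt := hμ.point trivial
  obtain ⟨s, u, hu⟩ := hμ.point trivial
  have hnat : ∀ x : (Aᶜ : Set X), ∃ k : ℕ, μ {(x : X)} = k := by
    intro x
    have hlt : μ {(x : X)} < ∞ := measure_lt_top_of_moment hA hne hμ.moment_lt_top
      (singleton_subset_iff.2 x.2) isCompact_singleton
    rw [hu, sum_dirac_apply _ (measurableSet_singleton _)] at hlt ⊢
    have h2 : (u ⁻¹' {(x : X)}).encard ≠ ⊤ := by
      intro h
      rw [h] at hlt
      simp at hlt
    obtain ⟨k, hk⟩ := ENat.ne_top_iff_exists.1 h2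
    exact ⟨k, by rw [← hk]; simp⟩
  choose σ hσ using hnat
  have hc : {x | σ x ≠ 0}.Countable := by
    refine ((countable_range u).preimage Subtype.val_injective).mono fun x hx => ?_
    by_contra hxr
    have h0 := hσ x
    rw [hu, sum_dirac_apply _ (measurableSet_singleton _)] at h0
    have : u ⁻¹' {(x : X)} = ∅ := by
      ext i
      simp only [mem_preimage, mem_singleton_iff, mem_empty_iff_false, iff_false]
      exact fun h => hxr ⟨i, h⟩
    rw [this] at h0
    apply hx
    simpa using h0.symm
  have e : diagramMeasure σ = μ := by
    refine (isPointMeasure_diagramMeasure hc).ext hpt fun x => ?_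
    by_cases hx : x ∈ A
    · rw [measure_mono_null (singleton_subset_iff.2 hx) (diagramMeasure_null hA σ),
        measure_mono_null (singleton_subset_iff.2 hx) hμ.null]
    · rw [hσ ⟨x, hx⟩]
      exact diagramMeasure_singleton σ ⟨x, hx⟩
  refine ⟨⟨σ, ?_⟩, e⟩
  rw [← moment_diagramMeasure hne, e]
  exact hμ.moment_lt_top

lemma diagramMeasure_injective :
    Function.Injective fun σ : PersistenceDiagrams 2 A => diagramMeasure σ.1 := by
  intro σ τ h
  refine Subtype.ext (funext fun x => ?_)
  have := congrArg (fun m : Measure X => m {(x : X)}) h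
  simp only [diagramMeasure_singleton] at this
  exact_mod_cast this

lemma enumerates_iff (hA : IsClosed A) (hne : A.Nonempty) (σ : PersistenceDiagrams 2 A)
    (u : ℕ → X) : Enumerates u σ.1 ↔
      (Measure.sum fun i => Measure.dirac (u i)).restrict Aᶜ = diagramMeasure σ.1 := by
  have hx : ∀ x : (Aᶜ : Set X), ((Measure.sum fun i => Measure.dirac (u i)).restrict Aᶜ) {(x : X)} =
      ({i | u i = x}.encard : ℝ≥0∞) := by
    intro x
    rw [Measure.restrict_apply (measurableSet_singleton _),
      inter_eq_left.2 (singleton_subset_iff.2 x.2), sum_dirac_apply _ (measurableSet_singleton _)]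
    rfl
  constructor
  · intro h
    refine ((isPointMeasure_sum_dirac u).restrict hA.measurableSet.compl).ext
      ((isAdmissible_diagramMeasure hA hne σ).point trivial) fun x => ?_
    by_cases hxA : x ∈ A
    · rw [measure_mono_null (singleton_subset_iff.2 hxA) (diagramMeasure_null hA σ.1),
        Measure.restrict_apply (measurableSet_singleton _)]
      have : {x} ∩ Aᶜ = ∅ := by
        ext y
        simp only [mem_inter_iff, mem_singleton_iff, mem_compl_iff, mem_empty_iff_false, iff_false]
        rintro ⟨rfl, h⟩
        exact h hxA
      simp [this]
    · rw [hx ⟨x, hxA⟩, h ⟨x, hxA⟩]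
      simpa using (diagramMeasure_singleton σ.1 ⟨x, hxA⟩).symm
  · intro h x
    have h1 := hx x
    rw [h, diagramMeasure_singleton] at h1
    exact_mod_cast h1.symm

/-- A pair of sequences is the same as a plan that is a sum of Dirac masses, once the plan is padded
to be indexed by `ℕ`. -/
lemma diagramDist_eq (hA : IsClosed A) (hne : A.Nonempty) (σ τ : PersistenceDiagrams 2 A) :
    diagramDist 2 σ τ =
      planCost True A (diagramMeasure σ.1) (diagramMeasure τ.1) ^ (1 / 2 : ℝ) := by
  have hcost : ∀ u v : ℕ → X, ∑' i, edist (u i) (v i) ^ (2 : ℝ) =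
      cost (Measure.sum fun i => Measure.dirac (u i, v i)) := by
    intro u v
    rw [cost, lintegral_sum_measure]
    simp_rw [lintegral_dirac' _ measurable_nndist_sq, edist_rpow_two]
  refine le_antisymm ?_ ?_
  · obtain ⟨γ, hγ, -, hc⟩ := exists_optimal_plan hA hne (isAdmissible_diagramMeasure hA hne σ)
      (isAdmissible_diagramMeasure hA hne τ)
    obtain ⟨a, ha⟩ := hne
    obtain ⟨s, w, hw⟩ := hγ.point trivial
    -- The index set `s` of the plan may be finite; infinitely many pairs `(a, a)` with `a ∈ A` make
    -- it denumerable and change neither the cost nor the marginals on `Ω`.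
    obtain ⟨_⟩ := nonempty_denumerable (s ⊕ ℕ)
    let e : s ⊕ ℕ ≃ ℕ := Denumerable.eqv _
    let W : ℕ → X × X := fun i => Sum.elim w (fun _ => (a, a)) (e.symm i)
    have hW : EqUpToDiag A (Measure.sum fun i => Measure.dirac (W i)) γ := by
      refine ⟨Measure.sum fun _ : ℕ => Measure.dirac a, ?_, ?_⟩
      · simp [Measure.sum_apply _ hA.measurableSet.compl, ha,
          Measure.dirac_apply' _ hA.measurableSet.compl]
      · rw [sum_dirac_map _ (by fun_prop), hw, sum_dirac_add]
        ext B hB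
        rw [Measure.sum_apply _ hB, Measure.sum_apply _ hB]
        exact e.symm.tsum_eq fun i => Measure.dirac (Sum.elim w (fun _ => (a, a)) i) B
    have h1 := hW.map_fst
    have h2 := hW.map_snd
    rw [sum_dirac_map _ measurable_fst, hγ.fst] at h1
    rw [sum_dirac_map _ measurable_snd, hγ.snd] at h2
    refine (iInf₂_le (fun i => (W i).1) (fun i => (W i).2)).trans ?_
    refine (iInf₂_le ((enumerates_iff hA ⟨a, ha⟩ σ _).2 h1)
      ((enumerates_iff hA ⟨a, ha⟩ τ _).2 h2)).trans_eq ?_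
    rw [hcost, ← hc, ← hW.cost_eq]
  · refine le_iInf₂ fun u v => le_iInf₂ fun hu hv => ENNReal.rpow_le_rpow ?_ (by norm_num)
    rw [hcost]
    refine planCost_le ⟨?_, ?_, fun _ => isPointMeasure_sum_dirac _⟩
    · rw [sum_dirac_map _ measurable_fst]
      exact (enumerates_iff hA hne σ u).1 hu
    · rw [sum_dirac_map _ measurable_snd]
      exact (enumerates_iff hA hne τ v).1 hv

end Diagrams

end Representations

end OptPartial

theorem theoremt {X : Type*} [MetricSpace X] [ProperSpace X] [MeasurableSpace X] [BorelSpace X]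
    (A : Set X) (hAclosed : IsClosed A) (hAne : A.Nonempty)
    (hX : OptPartial.IsNonnegCurvedAlexandrov X) :
    (∃ _ : MetricSpace (OptPartial.RadonMeasures 2 A),
      (∀ μ ν : OptPartial.RadonMeasures 2 A, edist μ ν = OptPartial.Wb 2 μ ν) ∧
        OptPartial.IsNonnegCurvedAlexandrov (OptPartial.RadonMeasures 2 A)) ∧
    (∃ _ : MetricSpace (OptPartial.PersistenceDiagrams 2 A),
      (∀ σ τ : OptPartial.PersistenceDiagrams 2 A, edist σ τ = OptPartial.diagramDist 2 σ τ) ∧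
        OptPartial.IsNonnegCurvedAlexandrov (OptPartial.PersistenceDiagrams 2 A)) := by
  constructor
  · refine OptPartial.exists_alexandrov_of_planCost False hAclosed hAne hX
      (fun μ : OptPartial.RadonMeasures 2 A => μ.1.map Subtype.val)
      ((OptPartial.map_val_injective hAclosed).comp Subtype.val_injective)
      (fun μ => (OptPartial.isAdmissible_map_val_iff hAclosed hAne μ.1).2 μ.2)
      (fun μ hμ => ?_) _ (OptPartial.Wb_eq hAclosed hAne)
    -- An admissible measure is null on `A`, so it is the image of its own restriction to `Ω`.
    have e := (OptPartial.comap_val_eq_iff hAclosed μ _).1 rfl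
    rw [OptPartial.restrict_compl_eq_self hμ.null] at e
    exact ⟨⟨_, (OptPartial.isAdmissible_map_val_iff hAclosed hAne _).1 (e ▸ hμ)⟩, e.symm⟩
  · exact OptPartial.exists_alexandrov_of_planCost True hAclosed hAne hX
      (fun σ : OptPartial.PersistenceDiagrams 2 A => OptPartial.diagramMeasure σ.1)
      OptPartial.diagramMeasure_injective (OptPartial.isAdmissible_diagramMeasure hAclosed hAne)
      (fun μ hμ => OptPartial.exists_diagramMeasure_eq hAclosed hAne hμ) _
      (OptPartial.diagramDist_eq hAclosed hAne)
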